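/- Let $G_{n,p}$ be the binomial random graph on $n$ vertices, in which each pair of vertices is joined independently with probability $p=p(n)$, let $d=pn$, and let $H_{n,p}$ be the largest connected component of $G_{n,p}$. An event holds a.a.s. if its probability tends to $1$ as $n\to\infty$. For a finite graph $H$, let $P$ be the transition matrix of the simple random walk on $H$ (from a vertex $v$ the walk moves to a uniformly random neighbour of $v$), let $\pi(v)=\deg(v)/(2|E(H)|)$, and let $d_{TV}(\mu,\nu)=\max_{A}|\mu(A)-\nu(A)|$. Define $$T_{mix}(H)=\sup_{x_0}\min\{t\ge 0:\ d_{TV}(x_0P^t,\pi)<1/e\},\qquad T'_{mix}(H)=\sup_{x_0}\min\{t\ge 1:\ d_{TV}(x_0P^{T_t},\pi)<1/e\},$$ where $x_0$ ranges over all probability distributions on $V(H)$, $T_t$ is uniform on $\{0,\dots,t-1\}$ (so $x_0P^{T_t}=\frac1t\sum_{s<t}x_0P^s$), and $\min\emptyset=\infty$. There is an absolute constant $c>0$ such that the following holds. Let $\varepsilon>0$ and let $p=p(n)$ satisfy, for all sufficiently large $n$, $$\frac{1+\varepsilon}{n}<p<\frac{\ln n}{5n}.$$ Then: 1. a.a.s.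 $H_{n,p}$ contains a path of length (number of edges) more than $\frac{\ln n}{4d}$ all of whose interior vertices have degree two; 2. a.a.s. $T_{mix}(H_{n,p})>\frac1{10}\left(\frac{\ln n}{8d}\right)^2$, and a.a.s. $T'_{mix}(H_{n,p})>c\left(\frac{\ln n}{d}\right)^2$; that is, both mixing times are $\Omega\left((\ln n/d)^2\right)$. (If several components have the maximum number of vertices, the assertions hold for each of them.) -/

import Mathlib

open Filter Topology
open scoped unitInterval ENNReal

noncomputable section

namespace GiantWalk

section Walk

variable {V : Type*} [Fintype V]

open scoped Classical in
/-- Transition matrix of the simple random walk on `G`: from `i` the walk moves to a uniformly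
chosen neighbour of `i`. -/
def transition (G : SimpleGraph V) : Matrix V V ℝ :=
  Matrix.of fun i j => if G.Adj i j then 1 / (G.degree i : ℝ) else 0

open scoped Classical in
/-- The stationary distribution `π(v) = d(v) / (2 |E(G)|)`. -/
def stationary (G : SimpleGraph V) (v : V) : ℝ :=
  (G.degree v : ℝ) / (2 * (G.edgeFinset.card : ℝ))

/-- Total variation distance: the maximum over all `A ⊆ V` of `|μ(A) - ν(A)|`. -/
def dTV (μ ν : V → ℝ) : ℝ :=
  ⨆ A : Finset V, |∑ v ∈ A, μ v - ∑ v ∈ A, ν v|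

open scoped Classical in
/-- The distribution `x₀ Pᵗ` of the walk after `t` steps, started from the distribution `x₀`. -/
def stepDist (G : SimpleGraph V) (x₀ : V → ℝ) (t : ℕ) : V → ℝ :=
  Matrix.vecMul x₀ (transition G ^ t)

/-- The distribution `x₀ P^T` for `T` uniformly distributed on `{0, …, t - 1}` (used for `t > 0`).
-/
def averagedDist (G : SimpleGraph V) (x₀ : V → ℝ) (t : ℕ) : V → ℝ :=
  fun v => (1 / (t : ℝ)) * ∑ s ∈ Finset.range t, stepDist G x₀ s v

/-- The mixing time: the supremum over all starting distributions `x₀` of the least `t` with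
`dTV(x₀ Pᵗ, π) < 1/e`; the least element of the empty set is `∞`. -/
def mixingTime (G : SimpleGraph V) : ℕ∞ :=
  ⨆ x₀ ∈ stdSimplex ℝ V,
    ⨅ t ∈ {t : ℕ | dTV (stepDist G x₀ t) (stationary G) < 1 / Real.exp 1}, (t : ℕ∞)

/-- The averaged mixing time: the supremum over all starting distributions `x₀` of the least
`t > 0` such that the walk stopped at a uniform time in `{0, …, t - 1}` is within `1/e` of `π`. -/
def averagedMixingTime (G : SimpleGraph V) : ℕ∞ :=
  ⨆ x₀ ∈ stdSimplex ℝ V,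
    ⨅ t ∈ {t : ℕ | 0 < t ∧ dTV (averagedDist G x₀ t) (stationary G) < 1 / Real.exp 1}, (t : ℕ∞)

open scoped Classical in
/-- `G` contains a path with more than `ℓ` edges all of whose interior vertices have degree two
in `G`. -/
def HasDegreeTwoPath (G : SimpleGraph V) (ℓ : ℝ) : Prop :=
  ∃ (u v : V) (w : G.Walk u v), w.IsPath ∧ ℓ < (w.length : ℝ) ∧
    ∀ i : ℕ, 0 < i → i < w.length → G.degree (w.getVert i) = 2

end Walk

/-- `C` has the maximum number of vertices among the connected components of `G`. -/
def IsLargest {V : Type*} {G : SimpleGraph V} (C : G.ConnectedComponent) : Prop :=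
  ∀ C' : G.ConnectedComponent, C'.supp.ncard ≤ C.supp.ncard

open scoped Classical in
/-- Asymptotically almost surely, the largest component `H` of the binomial random graph with
vertex set `Fin n` and edge probability `p n` has the property `Q n H`. In case of a tie for the
largest component, every component of maximum order is required to have the property. -/
def AASGiant (p : ℕ → I)
    (Q : ℕ → ∀ {W : Type} [Fintype W], SimpleGraph W → Prop) : Prop :=
  Tendsto
    (fun n : ℕ => SimpleGraph.binomialRandom (Fin n) (p n)
      {G | ∀ C : G.ConnectedComponent, IsLargest C → Q n C.toSimpleGraph})
    atTop (𝓝 1)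

end GiantWalk

end

/-! A long path with interior degrees two is a trap. Put x = ln n. On such a path with 2R edges the
parabola 1 - (i-R)²/R², extended by zero to the rest of the graph, loses at most 1/R² under one
application of P. So the walk started in the middle is still on the path at time t with probability
at least 1 - t/R². The interior has stationary mass at most 1/10 when there are at least 20R edges,
so for t ≤ R²/2 the distance to π is at least 1/2 - 1/10 = 2/5 ≥ 1/e, also after averaging over
times (`exists_trap`, `mixing_of_path`).

That every largest component contains such a path is shown by switching (`prob_deficient`). Take a
graph in which some largest component has none with L edges, choose a vertex of that component, and
hang on it a path made of L isolated vertices. The probability weight is multiplied by (p/(1-p))^L.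
The construction is injective: the attached graph determines the path and the original graph
(`Attachable.path_eq`, `Attachable.graph_eq`). With at least s attachment points and m isolated
vertices, the images have total weight at least Pr(deficient) · s · (m)_L · (p/(1-p))^L, where (m)_L
is the falling factorial; being disjoint, they have total weight at most 1.

Two second moment arguments supply m and s. The number of isolated vertices is concentrated and of
order n e^{-d} (`prob_isolatedCount`). Since d > 1 + ε, there is a.a.s. a path with about n^{12/25}
edges (`prob_no_path`), which gives s without any giant component theory; the correlations between
two paths are controlled by a weighted count of non-backtracking walks (`nbSum_le`). For L ≈ x/(4d)
and d < x/5 one has (mp)^L ≥ e^{-3} n^{-9/20}, and 9/20 < 12/25 < 1/2 lets both the switching and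
the path count succeed. -/

namespace GiantWalk

/-! ### Paths with interior degrees two slow down mixing -/

section Mixing

variable {V : Type*} [Fintype V]

theorem transition_nonneg (G : SimpleGraph V) (i j : V) : 0 ≤ transition G i j := by
  classical
  simp only [transition, Matrix.of_apply]
  split_ifs <;> positivity

open scoped Classical in
theorem transition_mulVec_apply (G : SimpleGraph V) (h : V → ℝ) (v : V) :
    (Matrix.mulVec (transition G) h) v =
      1 / (G.degree v : ℝ) * ∑ j ∈ G.neighborFinset v, h j := by
  simp only [Matrix.mulVec, dotProduct, transition, Matrix.of_apply, ite_mul, zero_mul]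
  rw [← Finset.sum_filter, Finset.mul_sum]
  refine Finset.sum_congr ?_ fun _ _ => rfl
  ext x
  simp

theorem transition_row_sum_le_one (G : SimpleGraph V) (v : V) : ∑ j, transition G v j ≤ 1 := by
  classical
  have h := transition_mulVec_apply G (fun _ => 1) v
  simp only [Matrix.mulVec, dotProduct, mul_one, Finset.sum_const, nsmul_eq_mul,
    SimpleGraph.card_neighborFinset_eq_degree] at h
  rw [h, one_div]
  exact inv_mul_le_one

theorem transition_pow_nonneg [DecidableEq V] (G : SimpleGraph V) (t : ℕ) (i j : V) :
    0 ≤ (transition G ^ t) i j := by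
  induction t generalizing i j with
  | zero =>
    rw [pow_zero, Matrix.one_apply]
    split_ifs <;> norm_num
  | succ t ih =>
    rw [pow_succ, Matrix.mul_apply]
    exact Finset.sum_nonneg fun k _ => mul_nonneg (ih i k) (transition_nonneg G k j)

/-- The loss δ per step adds up. Rows of P may sum to 0 (isolated vertices), but row sums at most 1
suffice because the constant being subtracted is nonnegative. -/
theorem transition_pow_mulVec_ge [DecidableEq V] (G : SimpleGraph V) (h : V → ℝ) {δ : ℝ}
    (hδ : 0 ≤ δ) (hP : ∀ v, h v - δ ≤ (Matrix.mulVec (transition G) h) v) (t : ℕ) (v : V) :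
    h v - t * δ ≤ (Matrix.mulVec (transition G ^ t) h) v := by
  induction t generalizing v with
  | zero => simp
  | succ t ih =>
    rw [pow_succ', ← Matrix.mulVec_mulVec]
    have h1 : ∑ j, transition G v j * (h j - t * δ) ≤
        (Matrix.mulVec (transition G) (Matrix.mulVec (transition G ^ t) h)) v := by
      simp only [Matrix.mulVec, dotProduct]
      exact Finset.sum_le_sum fun j _ =>
        mul_le_mul_of_nonneg_left (ih j) (transition_nonneg G v j)
    have h2 : ∑ j, transition G v j * (h j - t * δ) =
        (Matrix.mulVec (transition G) h) v - (∑ j, transition G v j) * (t * δ) := by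
      simp only [Matrix.mulVec, dotProduct, mul_sub, Finset.sum_sub_distrib, Finset.sum_mul]
    have h3 := mul_le_mul_of_nonneg_right (transition_row_sum_le_one G v)
      (by positivity : 0 ≤ (t : ℝ) * δ)
    have := hP v
    push_cast
    linarith

theorem le_dTV (μ ν : V → ℝ) (A : Finset V) : ∑ v ∈ A, μ v - ∑ v ∈ A, ν v ≤ dTV μ ν :=
  (le_abs_self _).trans
    (le_ciSup (f := fun A : Finset V => |∑ v ∈ A, μ v - ∑ v ∈ A, ν v|)
      (Set.toFinite _).bddAbove A)

open scoped Classical in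
theorem stepDist_nonneg (G : SimpleGraph V) (v x : V) (t : ℕ) :
    0 ≤ stepDist G (Pi.single v 1) t x := by
  rw [stepDist, Matrix.single_one_vecMul]
  exact transition_pow_nonneg G t v x

-- The indicator of A dominates h, so its expectation after t steps dominates that of h.
open scoped Classical in
theorem sum_stepDist_ge (G : SimpleGraph V) (h : V → ℝ) {δ : ℝ} (hδ : 0 ≤ δ)
    (hP : ∀ v, h v - δ ≤ (Matrix.mulVec (transition G) h) v) (A : Finset V)
    (hA : ∀ v ∈ A, h v ≤ 1) (hA' : ∀ v ∉ A, h v ≤ 0) (t : ℕ) (v : V) :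
    h v - t * δ ≤ ∑ x ∈ A, stepDist G (Pi.single v 1) t x := by
  refine (transition_pow_mulVec_ge G h hδ hP t v).trans ?_
  have : (Matrix.mulVec (transition G ^ t) h) v =
      ∑ x, stepDist G (Pi.single v 1) t x * h x := by
    simp only [stepDist, Matrix.single_one_vecMul, Matrix.mulVec, dotProduct]
    rfl
  have hsum : ∑ x ∈ A, stepDist G (Pi.single v 1) t x =
      ∑ x, if x ∈ A then stepDist G (Pi.single v 1) t x else 0 := by simp
  rw [this, hsum]
  refine Finset.sum_le_sum fun x _ => ?_
  have h0 := stepDist_nonneg G v x t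
  split_ifs with hx
  · exact mul_le_of_le_one_right h0 (hA x hx)
  · exact mul_nonpos_of_nonneg_of_nonpos h0 (hA' x hx)

open scoped Classical in
/-- If `f 0, …, f (2 R)` is a path whose interior vertices have degree two, there is a set `A`
carrying little stationary mass in which the walk started at `f R` stays for long. -/
theorem exists_trap (G : SimpleGraph V) (f : ℕ → V) {R : ℕ} (hR : 1 ≤ R)
    (hinj : Set.InjOn f (Set.Iic (2 * R))) (hadj : ∀ i < 2 * R, G.Adj (f i) (f (i + 1)))
    (hdeg : ∀ i, 0 < i → i < 2 * R → G.degree (f i) = 2)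
    (hE : 20 * R ≤ G.edgeFinset.card) :
    ∃ A : Finset V, ∑ v ∈ A, stationary G v ≤ 1 / 10 ∧
      ∀ t : ℕ, 1 - t * (1 / (R : ℝ) ^ 2) ≤ ∑ x ∈ A, stepDist G (Pi.single (f R) 1) t x := by
  have hR' : (0 : ℝ) < R := by exact_mod_cast hR
  -- The parabola has second difference -2/R², so averaging over the two neighbours loses exactly
  -- 1/R². It is 1 at the middle and 0 at both ends.
  set φ : ℕ → ℝ := fun i => 1 - ((i : ℝ) - R) ^ 2 / (R : ℝ) ^ 2 with hφ
  set A : Finset V := (Finset.Ioo 0 (2 * R)).image f with hA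
  set h : V → ℝ := fun v => ∑ i ∈ Finset.Ioo 0 (2 * R), if f i = v then φ i else 0 with hh
  have hφ0 : φ 0 = 0 := by simp [hφ, hR'.ne']
  have hφ2 : φ (2 * R) = 0 := by
    simp only [hφ]; push_cast; field_simp; ring
  have hφ1 : ∀ i, φ i ≤ 1 := fun i => by
    have : 0 ≤ ((i : ℝ) - R) ^ 2 / (R : ℝ) ^ 2 := by positivity
    simp only [hφ]; linarith
  have hφpos : ∀ i ≤ 2 * R, 0 ≤ φ i := fun i hi => by
    have hi' : (i : ℝ) ≤ 2 * R := by exact_mod_cast hi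
    have : ((i : ℝ) - R) ^ 2 / (R : ℝ) ^ 2 ≤ 1 := by
      rw [div_le_one (by positivity)]
      nlinarith [Nat.cast_nonneg (α := ℝ) i]
    simp only [hφ]; linarith
  have hhf : ∀ i ≤ 2 * R, h (f i) = φ i := by
    intro i hi
    have key : ∀ j ∈ Finset.Ioo 0 (2 * R), j ≠ i → (if f j = f i then φ j else 0) = 0 := by
      intro j hj hji
      rw [if_neg]
      intro hf
      exact hji (hinj (Set.mem_Iic.2 (Finset.mem_Ioo.1 hj).2.le) (Set.mem_Iic.2 hi) hf)
    by_cases hmem : i ∈ Finset.Ioo 0 (2 * R)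
    · simp only [hh]
      rw [Finset.sum_eq_single_of_mem i hmem key, if_pos rfl]
    · have : h (f i) = 0 :=
        Finset.sum_eq_zero fun j hj => key j hj fun hji => hmem (hji ▸ hj)
      rw [this]
      rw [Finset.mem_Ioo] at hmem
      obtain rfl | rfl : i = 0 ∨ i = 2 * R := by omega
      · exact hφ0.symm
      · exact hφ2.symm
  have hh0 : ∀ v, 0 ≤ h v := fun v => Finset.sum_nonneg fun i hi => by
    split_ifs
    · exact hφpos i (Finset.mem_Ioo.1 hi).2.le
    · exact le_rfl
  have hhA' : ∀ v ∉ A, h v ≤ 0 := by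
    intro v hv
    refine le_of_eq (Finset.sum_eq_zero fun i hi => ?_)
    rw [if_neg]
    rintro rfl
    exact hv (Finset.mem_image_of_mem f hi)
  have hhA : ∀ v ∈ A, h v ≤ 1 := by
    intro v hv
    obtain ⟨i, hi, rfl⟩ := Finset.mem_image.1 hv
    rw [hhf i (Finset.mem_Ioo.1 hi).2.le]
    exact hφ1 i
  have hP : ∀ v, h v - 1 / (R : ℝ) ^ 2 ≤ (Matrix.mulVec (transition G) h) v := by
    intro v
    have hδ : 0 ≤ 1 / (R : ℝ) ^ 2 := by positivity
    rw [transition_mulVec_apply]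
    by_cases hv : v ∈ A
    · obtain ⟨i, hi, rfl⟩ := Finset.mem_image.1 hv
      obtain ⟨hi0, hi2⟩ := Finset.mem_Ioo.1 hi
      obtain ⟨j, rfl⟩ : ∃ j, i = j + 1 := ⟨i - 1, by omega⟩
      have hne : f j ≠ f (j + 2) := fun hf => by
        have := hinj (Set.mem_Iic.2 (by omega)) (Set.mem_Iic.2 (by omega)) hf
        omega
      have hN : G.neighborFinset (f (j + 1)) = {f j, f (j + 2)} := by
        symm
        refine Finset.eq_of_subset_of_card_le ?_ ?_
        · intro x hx
          rw [SimpleGraph.mem_neighborFinset]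
          rcases Finset.mem_insert.1 hx with rfl | hx
          · exact (hadj j (by omega)).symm
          · rw [Finset.mem_singleton.1 hx]
            exact hadj (j + 1) (by omega)
        · rw [SimpleGraph.card_neighborFinset_eq_degree, hdeg _ hi0 hi2, Finset.card_pair hne]
      rw [hN, hdeg _ hi0 hi2, Finset.sum_pair hne, hhf _ (by omega), hhf _ (by omega),
        hhf _ (by omega)]
      simp only [hφ]
      push_cast
      apply le_of_eq
      field_simp
      ring
    -- Off the interior h vanishes and Ph ≥ 0, so nothing is needed about degrees at or beyond the
    -- endpoints.
    · have h1 := hhA' v hv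
      have h2 : 0 ≤ 1 / (G.degree v : ℝ) * ∑ j ∈ G.neighborFinset v, h j :=
        mul_nonneg (by positivity) (Finset.sum_nonneg fun j _ => hh0 j)
      linarith
  refine ⟨A, ?_, fun t => ?_⟩
  · have hE' : (20 : ℝ) * R ≤ G.edgeFinset.card := by exact_mod_cast hE
    have hcard : (A.card : ℝ) ≤ 2 * R := by
      have := (Finset.card_image_le (s := Finset.Ioo 0 (2 * R)) (f := f))
      rw [Nat.card_Ioo, ← hA] at this
      have h2 : A.card ≤ 2 * R := by omega
      exact_mod_cast h2
    have : ∑ v ∈ A, stationary G v = A.card * (2 / (2 * (G.edgeFinset.card : ℝ))) := by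
      rw [← nsmul_eq_mul]
      refine Finset.sum_eq_card_nsmul fun v hv => ?_
      obtain ⟨i, hi, rfl⟩ := Finset.mem_image.1 hv
      obtain ⟨hi0, hi2⟩ := Finset.mem_Ioo.1 hi
      rw [stationary, hdeg i hi0 hi2]
      norm_num
    rw [this, mul_div_assoc', div_le_iff₀ (by linarith)]
    linarith
  · have h1 := sum_stepDist_ge G h (by positivity) hP A hhA hhA' t (f R)
    rw [hhf R (by omega)] at h1
    simpa [hφ] using h1

theorem inv_exp_one_le : 1 / Real.exp 1 ≤ 2 / 5 := by
  have := Real.exp_one_gt_d9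
  rw [div_le_div_iff₀ (Real.exp_pos 1) (by norm_num)]
  linarith

/-- Passing to the integer ⌊B⌋ + 1 keeps the inequality strict through the infimum; for empty S the
infimum is ∞. -/
theorem lt_iInf_cast {S : Set ℕ} {B : ℝ} (hB : 0 ≤ B) (hS : ∀ t ∈ S, B < t) :
    ENNReal.ofReal B < ((⨅ t ∈ S, (t : ℕ∞) : ℕ∞) : ℝ≥0∞) := by
  have h1 : ((⌊B⌋₊ + 1 : ℕ) : ℕ∞) ≤ ⨅ t ∈ S, (t : ℕ∞) := by
    refine le_iInf₂ fun t ht => ?_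
    exact_mod_cast (Nat.floor_lt hB).2 (hS t ht)
  refine lt_of_lt_of_le ?_ (ENat.toENNReal_le.2 h1)
  rw [ENat.toENNReal_coe, ← ENNReal.ofReal_natCast, ENNReal.ofReal_lt_ofReal_iff (by positivity)]
  push_cast
  exact Nat.lt_floor_add_one B

-- At every time up to B the trap holds mass at least 1/2, against 1/10 for π, a gap of 2/5 ≥ 1/e.
-- An average over times up to B inherits the bound 1/2.
open scoped Classical in
theorem mixing_of_path (G : SimpleGraph V) (f : ℕ → V) {R : ℕ} (hR : 1 ≤ R)
    (hinj : Set.InjOn f (Set.Iic (2 * R))) (hadj : ∀ i < 2 * R, G.Adj (f i) (f (i + 1)))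
    (hdeg : ∀ i, 0 < i → i < 2 * R → G.degree (f i) = 2)
    (hE : 20 * R ≤ G.edgeFinset.card) {B : ℝ} (hB0 : 0 ≤ B)
    (hB : ∀ t : ℕ, (t : ℝ) ≤ B → 2 * (t : ℝ) ≤ (R : ℝ) ^ 2) :
    ENNReal.ofReal B < ((mixingTime G : ℕ∞) : ℝ≥0∞) ∧
      ENNReal.ofReal B < ((averagedMixingTime G : ℕ∞) : ℝ≥0∞) := by
  obtain ⟨A, hA, hstep⟩ := exists_trap G f hR hinj hadj hdeg hE
  have hR' : (0 : ℝ) < (R : ℝ) ^ 2 := by positivity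
  have hmem : Pi.single (f R) (1 : ℝ) ∈ stdSimplex ℝ V := single_mem_stdSimplex ℝ (f R)
  have hstep' : ∀ t : ℕ, (t : ℝ) ≤ B → 1 / 2 ≤ ∑ x ∈ A, stepDist G (Pi.single (f R) 1) t x := by
    intro t ht
    have h1 := hstep t
    have h2 : (t : ℝ) * (1 / (R : ℝ) ^ 2) ≤ 1 / 2 := by
      rw [mul_one_div, div_le_iff₀ hR']
      linarith [hB t ht]
    linarith
  have he := inv_exp_one_le
  constructor
  · refine (lt_iInf_cast hB0 (S := {t : ℕ | dTV (stepDist G (Pi.single (f R) 1) t) (stationary G) <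
      1 / Real.exp 1}) ?_).trans_le ?_
    · intro t ht
      by_contra! hlt
      have h1 := le_dTV (stepDist G (Pi.single (f R) 1) t) (stationary G) A
      have h2 := hstep' t hlt
      have h3 : dTV (stepDist G (Pi.single (f R) 1) t) (stationary G) < 1 / Real.exp 1 := ht
      linarith
    · exact ENat.toENNReal_le.2 (le_iSup₂_of_le (Pi.single (f R) (1 : ℝ)) hmem le_rfl)
  · refine (lt_iInf_cast hB0 (S := {t : ℕ | 0 < t ∧
      dTV (averagedDist G (Pi.single (f R) 1) t) (stationary G) < 1 / Real.exp 1}) ?_).trans_le ?_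
    · rintro t ⟨ht0, ht⟩
      by_contra! hlt
      have h1 := le_dTV (averagedDist G (Pi.single (f R) 1) t) (stationary G) A
      have ht0' : (0 : ℝ) < t := by exact_mod_cast ht0
      have h2 : 1 / 2 ≤ ∑ x ∈ A, averagedDist G (Pi.single (f R) 1) t x := by
        simp only [averagedDist]
        rw [← Finset.mul_sum, Finset.sum_comm, one_div_mul_eq_div, le_div_iff₀ ht0']
        have h3 : ∑ s ∈ Finset.range t, (1 / 2 : ℝ) ≤
            ∑ s ∈ Finset.range t, ∑ x ∈ A, stepDist G (Pi.single (f R) 1) s x := by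
          refine Finset.sum_le_sum fun s hs => hstep' s ?_
          have : (s : ℝ) ≤ t := by exact_mod_cast (Finset.mem_range.1 hs).le
          linarith
        simp only [Finset.sum_const, Finset.card_range, nsmul_eq_mul] at h3
        linarith
      linarith
    · exact ENat.toENNReal_le.2 (le_iSup₂_of_le (Pi.single (f R) (1 : ℝ)) hmem le_rfl)

open scoped Classical in
/-- A path of more than `2 μ` edges whose interior vertices have degree two forces both mixing
times to exceed `μ ^ 2 / 10`. -/
theorem mixing_of_hasDegreeTwoPath (G : SimpleGraph V) {μ : ℝ} (hμ : 1 / 2 ≤ μ)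
    (hpath : HasDegreeTwoPath G (2 * μ)) (hE : 20 * μ + 10 ≤ G.edgeFinset.card) :
    ENNReal.ofReal (1 / 10 * μ ^ 2) < ((mixingTime G : ℕ∞) : ℝ≥0∞) ∧
      ENNReal.ofReal (1 / 10 * μ ^ 2) < ((averagedMixingTime G : ℕ∞) : ℝ≥0∞) := by
  obtain ⟨u, v, w, hw, hlen, hdeg⟩ := hpath
  -- Only an initial segment of the path is used, so that 20 R ≤ 10 L ≤ 20 μ + 10 stays below the
  -- number of edges.
  set L := ⌊2 * μ⌋₊ + 1 with hL
  have hLw : L ≤ w.length := by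
    rw [hL]
    have : ⌊2 * μ⌋₊ < w.length := (Nat.floor_lt (by linarith)).2 hlen
    omega
  have hL1 : 2 * μ < L := by rw [hL]; push_cast; exact Nat.lt_floor_add_one _
  have hL2 : (L : ℝ) ≤ 2 * μ + 1 := by
    rw [hL]; push_cast; linarith [Nat.floor_le (show 0 ≤ 2 * μ by linarith)]
  set R := L / 2 with hRdef
  have hLge : 2 ≤ L := by
    have : (1 : ℝ) < L := by linarith
    exact_mod_cast this
  have hR1 : 1 ≤ R := by omega
  have hRL : (L : ℝ) ≤ 2 * R + 1 := by
    have : L ≤ 2 * R + 1 := by omega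
    exact_mod_cast this
  have hRL' : 2 * (R : ℝ) ≤ L := by
    have : 2 * R ≤ L := by omega
    exact_mod_cast this
  refine mixing_of_path G w.getVert hR1 ?_ ?_ ?_ ?_ (by positivity) ?_
  · refine hw.getVert_injOn.mono fun i hi => ?_
    have := Set.mem_Iic.1 hi
    show i ≤ w.length
    omega
  · intro i hi
    exact w.adj_getVert_succ (by omega)
  · intro i hi0 hi
    exact hdeg i hi0 (by omega)
  · have : (20 : ℝ) * R ≤ G.edgeFinset.card := by linarith
    exact_mod_cast this
  · intro t ht
    rcases Nat.eq_zero_or_pos t with rfl | h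
    · simp
    · have h1 : (1 : ℝ) ≤ t := by exact_mod_cast h
      -- A positive integer t ≤ μ²/10 forces μ ≥ 3; then the rounding loss in R ≥ μ - 1/2 is
      -- harmless and R² ≥ μ²/5 ≥ 2t.
      have h2 : 3 ≤ μ := by nlinarith
      nlinarith

end Mixing

/-! ### The binomial random graph as a finite weighted sum -/

section Binomial

open scoped Classical in
/-- The pairs of distinct vertices. -/
noncomputable def pairs (V : Type*) [Fintype V] : Finset (Sym2 V) :=
  Finset.univ.filter fun e => ¬ e.IsDiag

variable {V : Type*} [Fintype V]

theorem mem_pairs {e : Sym2 V} : e ∈ pairs V ↔ ¬ e.IsDiag := by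
  classical
  simp [pairs]

theorem card_pairs : (pairs V).card = (Nat.card V).choose 2 := by
  classical
  rw [Nat.card_eq_fintype_card, ← Sym2.card_diagSet_compl, ← Set.toFinset_card]
  congr 1
  ext e
  simp [mem_pairs]

open scoped Classical in
theorem edgeFinset_subset_pairs (G : SimpleGraph V) : G.edgeFinset ⊆ pairs V := fun _ he =>
  mem_pairs.2 (G.not_isDiag_of_mem_edgeFinset he)

open scoped Classical in
/-- The probability of `G` in the binomial model. -/
noncomputable def weight (p : ℝ) (G : SimpleGraph V) : ℝ :=
  p ^ G.edgeFinset.card * (1 - p) ^ ((pairs V).card - G.edgeFinset.card)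

theorem weight_nonneg {p : ℝ} (h0 : 0 ≤ p) (h1 : p ≤ 1) (G : SimpleGraph V) : 0 ≤ weight p G :=
  mul_nonneg (pow_nonneg h0 _) (pow_nonneg (by linarith) _)

open scoped Classical in
theorem sum_edgeFinset (F : Finset (Sym2 V) → ℝ) :
    ∑ G : SimpleGraph V, F G.edgeFinset = ∑ S ∈ (pairs V).powerset, F S := by
  refine Finset.sum_bij' (fun G _ => G.edgeFinset)
    (fun S _ => SimpleGraph.fromEdgeSet (S : Set (Sym2 V))) ?_ ?_ ?_ ?_ ?_
  · exact fun G _ => Finset.mem_powerset.2 (edgeFinset_subset_pairs G)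
  · exact fun _ _ => Finset.mem_univ _
  · intro G _
    simp
  · intro S hS
    ext e
    simp only [SimpleGraph.mem_edgeFinset, SimpleGraph.edgeSet_fromEdgeSet, Set.mem_sdiff,
      Finset.mem_coe]
    exact ⟨fun h => h.1, fun h => ⟨h, mem_pairs.1 (Finset.mem_powerset.1 hS h)⟩⟩
  · exact fun _ _ => rfl

open scoped Classical in
/-- The probability that all pairs of `A` are edges and no pair of `B` is one. -/
theorem sum_weight_edges (p : ℝ) {A B : Finset (Sym2 V)} (hA : A ⊆ pairs V) (hB : B ⊆ pairs V)
    (hAB : Disjoint A B) :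
    ∑ G : SimpleGraph V, weight p G *
      (if A ⊆ G.edgeFinset ∧ Disjoint B G.edgeFinset then 1 else 0) =
      p ^ A.card * (1 - p) ^ B.card := by
  have h1 := sum_edgeFinset (V := V) fun S =>
    p ^ S.card * (1 - p) ^ ((pairs V).card - S.card) * (if A ⊆ S ∧ Disjoint B S then 1 else 0)
  simp only [weight]
  rw [h1]
  -- Expanding the product over all pairs gives a sum over edge sets S. The zeros, placed on B for
  -- present pairs and on A for absent ones, kill exactly the sets violating the two conditions.
  have h2 := Finset.prod_add (fun e => if e ∈ B then 0 else p)
    (fun e => if e ∈ A then 0 else 1 - p) (pairs V)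
  have h3 : ∏ e ∈ pairs V, ((if e ∈ B then 0 else p) + (if e ∈ A then 0 else 1 - p)) =
      p ^ A.card * (1 - p) ^ B.card := by
    have h4 : ∀ e ∈ pairs V, ((if e ∈ B then 0 else p) + (if e ∈ A then 0 else 1 - p)) =
        (if e ∈ A then p else 1) * (if e ∈ B then 1 - p else 1) := by
      intro e _
      by_cases ha : e ∈ A
      · simp [ha, Finset.disjoint_left.1 hAB ha]
      · by_cases hb : e ∈ B <;> simp [ha, hb]
    rw [Finset.prod_congr rfl h4, Finset.prod_mul_distrib, Finset.prod_ite_mem,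
      Finset.prod_ite_mem, Finset.inter_eq_right.2 hA, Finset.inter_eq_right.2 hB]
    simp
  rw [← h3, h2]
  refine Finset.sum_congr rfl fun S hS => ?_
  have hS := Finset.mem_powerset.1 hS
  by_cases hc : A ⊆ S ∧ Disjoint B S
  · rw [if_pos hc, mul_one]
    congr 1
    · rw [Finset.prod_congr rfl fun e he => if_neg (Finset.disjoint_right.1 hc.2 he),
        Finset.prod_const]
    · rw [Finset.prod_congr rfl fun e he =>
        if_neg fun ha => (Finset.mem_sdiff.1 he).2 (hc.1 ha)]
      simp [Finset.card_sdiff_of_subset hS]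
  · rw [if_neg hc, mul_zero]
    symm
    by_cases hAS : A ⊆ S
    · obtain ⟨e, heB, heS⟩ := Finset.not_disjoint_iff.1 fun h => hc ⟨hAS, h⟩
      rw [Finset.prod_eq_zero (i := e) heS (by simp [heB]), zero_mul]
    · obtain ⟨e, heA, heS⟩ := Finset.not_subset.1 hAS
      rw [Finset.prod_eq_zero (i := e) (s := pairs V \ S) (Finset.mem_sdiff.2 ⟨hA heA, heS⟩)
        (by simp [heA]), mul_zero]

open scoped Classical in
theorem sum_weight (p : ℝ) : ∑ G : SimpleGraph V, weight p G = 1 := by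
  simpa using sum_weight_edges (V := V) p (Finset.empty_subset _) (Finset.empty_subset _)
    (Finset.disjoint_empty_left _)

open scoped Classical in
/-- The probability of a set of graphs in the binomial model. -/
noncomputable def prob (p : ℝ) (S : Set (SimpleGraph V)) : ℝ :=
  ∑ G : SimpleGraph V, weight p G * (if G ∈ S then 1 else 0)

theorem prob_nonneg {p : ℝ} (h0 : 0 ≤ p) (h1 : p ≤ 1) (S : Set (SimpleGraph V)) :
    0 ≤ prob p S := by
  classical
  refine Finset.sum_nonneg fun G _ => mul_nonneg (weight_nonneg h0 h1 G) ?_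
  split_ifs <;> norm_num

theorem prob_mono {p : ℝ} (h0 : 0 ≤ p) (h1 : p ≤ 1) {S T : Set (SimpleGraph V)} (h : S ⊆ T) :
    prob p S ≤ prob p T := by
  classical
  refine Finset.sum_le_sum fun G _ => mul_le_mul_of_nonneg_left ?_ (weight_nonneg h0 h1 G)
  by_cases hS : G ∈ S
  · simp [hS, h hS]
  · rw [if_neg hS]
    split_ifs <;> norm_num

theorem prob_union_le {p : ℝ} (h0 : 0 ≤ p) (h1 : p ≤ 1) (S T : Set (SimpleGraph V)) :
    prob p (S ∪ T) ≤ prob p S + prob p T := by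
  classical
  rw [prob, prob, prob, ← Finset.sum_add_distrib]
  refine Finset.sum_le_sum fun G _ => ?_
  rw [← mul_add]
  refine mul_le_mul_of_nonneg_left ?_ (weight_nonneg h0 h1 G)
  by_cases hS : G ∈ S <;> by_cases hT : G ∈ T <;> simp [hS, hT]

theorem prob_compl (p : ℝ) (S : Set (SimpleGraph V)) : prob p Sᶜ = 1 - prob p S := by
  classical
  rw [eq_sub_iff_add_eq, prob, prob, ← Finset.sum_add_distrib]
  refine Eq.trans ?_ (sum_weight (V := V) p)
  refine Finset.sum_congr rfl fun G _ => ?_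
  by_cases hS : G ∈ S <;> simp [hS]

/-- Lets all probability estimates be done with finite real sums, returning to the measure only at
the end. -/
theorem binomialRandom_eq_prob (p : I) (S : Set (SimpleGraph V)) :
    SimpleGraph.binomialRandom V p S = ENNReal.ofReal (prob (p : ℝ) S) := by
  classical
  have h0 := p.2.1
  have h1 := p.2.2
  have hS : S = ((Finset.univ.filter (· ∈ S) : Finset (SimpleGraph V)) : Set (SimpleGraph V)) := by
    ext; simp
  rw [prob]
  simp only [mul_ite, mul_one, mul_zero]
  rw [← Finset.sum_filter, ENNReal.ofReal_sum_of_nonneg fun G _ => weight_nonneg h0 h1 G]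
  conv_lhs => rw [hS]
  have : MeasurableSingletonClass (SimpleGraph V) := ⟨fun G => by
    rw [← SimpleGraph.measurableEmbedding_edgeSet.measurableSet_image, Set.image_singleton]
    exact measurableSet_singleton _⟩
  rw [← MeasureTheory.sum_measure_singleton]
  refine Finset.sum_congr rfl fun G _ => ?_
  have h2 : G.edgeSet.ncard = G.edgeFinset.card := by
    rw [Set.ncard_eq_toFinset_card', SimpleGraph.edgeFinset]
  rw [SimpleGraph.binomialRandom_singleton, weight, ENNReal.ofReal_mul (pow_nonneg h0 _),
    ENNReal.ofReal_pow h0, ENNReal.ofReal_pow (by linarith), card_pairs, h2]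
  congr 2
  · rw [ENNReal.ofReal, Real.toNNReal_of_nonneg h0]; rfl
  · rw [ENNReal.ofReal, Real.toNNReal_of_nonneg (by linarith)]; rfl

open scoped Classical in
/-- Second moment method: a random variable `X` whose second moment is close to the square of its
mean `m` is unlikely to be below `(1 - δ) m`. -/
theorem prob_chebyshev {p : ℝ} (h0 : 0 ≤ p) (h1 : p ≤ 1) (X : SimpleGraph V → ℝ) {m η δ : ℝ}
    (hm : 0 < m) (hδ : 0 < δ) (hX : ∑ G, weight p G * X G = m)
    (hX2 : ∑ G, weight p G * X G ^ 2 ≤ (1 + η) * m ^ 2) :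
    prob p {G | X G ≤ (1 - δ) * m} ≤ η / δ ^ 2 := by
  rw [le_div_iff₀ (by positivity)]
  have h2 : prob p {G | X G ≤ (1 - δ) * m} * (δ ^ 2 * m ^ 2) ≤
      ∑ G, weight p G * (X G - m) ^ 2 := by
    rw [prob, Finset.sum_mul]
    refine Finset.sum_le_sum fun G _ => ?_
    rw [mul_assoc]
    refine mul_le_mul_of_nonneg_left ?_ (weight_nonneg h0 h1 G)
    split_ifs with h
    · have h : X G ≤ (1 - δ) * m := h
      have : 0 < δ * m := by positivity
      nlinarith
    · rw [zero_mul]; positivity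
  have h3 : ∑ G, weight p G * (X G - m) ^ 2 =
      ∑ G, weight p G * X G ^ 2 - 2 * m * ∑ G, weight p G * X G +
        m ^ 2 * ∑ G : SimpleGraph V, weight p G := by
    rw [Finset.mul_sum, Finset.mul_sum, ← Finset.sum_sub_distrib, ← Finset.sum_add_distrib]
    exact Finset.sum_congr rfl fun G _ => by ring
  rw [h3, hX, sum_weight] at h2
  have hm2 : 0 < m ^ 2 := by positivity
  have : (prob p {G | X G ≤ (1 - δ) * m} * δ ^ 2) * m ^ 2 ≤ η * m ^ 2 := by linarith
  exact le_of_mul_le_mul_right this hm2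

end Binomial

/-! ### Concentration of the number of isolated vertices -/

section Isolated

variable {V : Type*} [Fintype V]

open scoped Classical in
/-- The pairs containing `v`. -/
noncomputable def star (v : V) : Finset (Sym2 V) :=
  (Finset.univ.erase v).image fun w => s(v, w)

open scoped Classical in
theorem mem_star {v : V} {e : Sym2 V} : e ∈ star v ↔ v ∈ e ∧ ¬ e.IsDiag := by
  induction e with | _ x y =>
  simp only [star, Finset.mem_image, Finset.mem_erase, Finset.mem_univ, and_true, Sym2.mem_iff,
    Sym2.mk_isDiag_iff]
  constructor
  · rintro ⟨w, hw, h⟩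
    rcases Sym2.eq_iff.1 h with ⟨rfl, rfl⟩ | ⟨rfl, rfl⟩
    · exact ⟨Or.inl rfl, hw.symm⟩
    · exact ⟨Or.inr rfl, hw⟩
  · rintro ⟨rfl | rfl, h⟩
    · exact ⟨y, Ne.symm h, rfl⟩
    · exact ⟨x, h, Sym2.eq_swap⟩

theorem star_subset_pairs (v : V) : star v ⊆ pairs V := fun _ he =>
  mem_pairs.2 (mem_star.1 he).2

theorem card_star (v : V) : (star v).card = Fintype.card V - 1 := by
  classical
  rw [star, Finset.card_image_of_injective _ fun x y h => Sym2.congr_right.1 h,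
    Finset.card_erase_of_mem (Finset.mem_univ v), Finset.card_univ]

-- The two stars of n - 1 pairs share just the pair {v, w}, leaving 2n - 3; written additively to
-- avoid truncated subtraction.
open scoped Classical in
theorem card_star_union {v w : V} (hvw : v ≠ w) :
    (star v ∪ star w).card + 3 = 2 * Fintype.card V := by
  have h1 : star v ∩ star w = {s(v, w)} := by
    ext e
    rw [Finset.mem_inter, mem_star, mem_star, Finset.mem_singleton]
    constructor
    · rintro ⟨⟨hv, _⟩, hw, _⟩
      exact (Sym2.mem_and_mem_iff hvw).1 ⟨hv, hw⟩
    · rintro rfl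
      simp [hvw]
  have h2 := Finset.card_union_add_card_inter (star v) (star w)
  rw [h1, Finset.card_singleton, card_star, card_star] at h2
  have h3 : 2 ≤ Fintype.card V := by
    have := Finset.card_le_univ ({v, w} : Finset V)
    rwa [Finset.card_pair hvw] at this
  omega

/-- The vertex `v` has no neighbour. -/
def IsIsolated (G : SimpleGraph V) (v : V) : Prop := ∀ w, ¬ G.Adj v w

open scoped Classical in
theorem isIsolated_iff (G : SimpleGraph V) (v : V) :
    IsIsolated G v ↔ Disjoint (star v) G.edgeFinset := by
  rw [Finset.disjoint_left]
  constructor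
  · intro h e he he'
    have hm := (mem_star.1 he).1
    obtain ⟨w, rfl⟩ := Sym2.mem_iff_exists.1 hm
    exact h w (by simpa using he')
  · intro h w hw
    refine h (a := s(v, w)) (mem_star.2 ⟨by simp, ?_⟩) (by simpa using hw)
    simpa using hw.ne

open scoped Classical in
/-- The number of isolated vertices. -/
noncomputable def isolatedCount (G : SimpleGraph V) : ℕ :=
  (Finset.univ.filter fun v => IsIsolated G v).card

/-- The number of isolated vertices is concentrated around its mean. -/
theorem prob_isolatedCount {p : ℝ} (h0 : 0 ≤ p) (h1 : p < 1) {m δ : ℝ} [Nonempty V]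
    (hm : m = Fintype.card V * (1 - p) ^ (Fintype.card V - 1)) (hδ : 0 < δ) :
    prob p {G : SimpleGraph V | (isolatedCount G : ℝ) ≤ (1 - δ) * m} ≤
      (1 / m + p / (1 - p)) / δ ^ 2 := by
  classical
  have hq : 0 < 1 - p := by linarith
  set n := Fintype.card V with hn
  have hnpos : 0 < n := Fintype.card_pos
  have hmpos : 0 < m := by rw [hm]; positivity
  have hX : ∀ G : SimpleGraph V, (isolatedCount G : ℝ) = ∑ v, if IsIsolated G v then 1 else 0 := by
    intro G
    rw [isolatedCount, Finset.card_filter]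
    push_cast
    rfl
  have hone : ∀ v : V, ∑ G : SimpleGraph V, weight p G * (if IsIsolated G v then 1 else 0) =
      (1 - p) ^ (n - 1) := by
    intro v
    have := sum_weight_edges p (Finset.empty_subset _) (star_subset_pairs v)
      (Finset.disjoint_empty_left _)
    rw [card_star, Finset.card_empty, pow_zero, one_mul] at this
    rw [← this]
    simp [isIsolated_iff]
  refine prob_chebyshev h0 h1.le (fun G => (isolatedCount G : ℝ)) hmpos hδ ?_ ?_
  · simp only [hX, Finset.mul_sum]
    rw [Finset.sum_comm, Finset.sum_congr rfl fun v _ => hone v, Finset.sum_const, hm,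
      Finset.card_univ, nsmul_eq_mul]
  · simp only [hX, pow_two, Finset.sum_mul_sum]
    simp only [Finset.mul_sum]
    rw [Finset.sum_comm, Finset.sum_congr rfl fun v _ => Finset.sum_comm]
    -- Distinct vertices are both isolated with probability (1-p)^(2n-3), a factor 1/(1-p) above
    -- independence. Summing gives m + m²/(1-p), that is, relative excess 1/m + p/(1-p) over m².
    have hpair : ∀ v w : V, ∑ G : SimpleGraph V, weight p G *
        ((if IsIsolated G v then 1 else 0) * (if IsIsolated G w then 1 else 0)) ≤
        (if v = w then (1 - p) ^ (n - 1) else 0) +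
          (1 - p) ^ (n - 1) * (1 - p) ^ (n - 1) / (1 - p) := by
      intro v w
      by_cases hvw : v = w
      · subst hvw
        rw [if_pos rfl, ← hone v]
        refine le_add_of_le_of_nonneg (Finset.sum_le_sum fun G _ => ?_) ?_
        · split_ifs <;> simp
        · rw [hone v]; positivity
      · rw [if_neg hvw, zero_add]
        have := sum_weight_edges p (Finset.empty_subset _)
          (Finset.union_subset (star_subset_pairs v) (star_subset_pairs w))
          (Finset.disjoint_empty_left _)
        rw [Finset.card_empty, pow_zero, one_mul] at this
        have hc := card_star_union hvw
        have hpow : (1 - p) ^ (n - 1) * (1 - p) ^ (n - 1) / (1 - p) =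
            (1 - p) ^ (star v ∪ star w).card := by
          rw [div_eq_iff hq.ne', ← pow_add, ← pow_succ]
          congr 1
          omega
        rw [hpow, ← this]
        apply le_of_eq
        refine Finset.sum_congr rfl fun G _ => ?_
        simp only [isIsolated_iff, Finset.disjoint_union_left]
        by_cases ha : Disjoint (star v) G.edgeFinset <;>
          by_cases hb : Disjoint (star w) G.edgeFinset <;> simp [ha, hb]
    refine (Finset.sum_le_sum fun v _ => Finset.sum_le_sum fun w _ => hpair v w).trans ?_
    simp only [Finset.sum_add_distrib, Finset.sum_ite_eq, Finset.mem_univ, if_true,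
      Finset.sum_const, Finset.card_univ, nsmul_eq_mul, ← hn]
    apply le_of_eq
    have hn' : (n : ℝ) ≠ 0 := by positivity
    have hpw : (1 - p) ^ (n - 1) ≠ 0 := by positivity
    rw [hm]
    field_simp
    ring

end Isolated

/-! ### Weighted counts of non-backtracking walks -/

section NonBacktracking

variable {V : Type*} [Fintype V]

open scoped Classical in
/-- The total weight of the non-backtracking walks with `j` steps that start at `x`, coming from
`y`, where a step along an edge of `H` has weight `b` and every other step has weight `1`. -/
noncomputable def nbSum (H : SimpleGraph V) (b : ℝ) : ℕ → Option V → V → ℝ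
  | 0, _, _ => 1
  | j + 1, y, x =>
    ∑ z, if some z = y then 0 else (if H.Adj x z then b else 1) * nbSum H b j (some x) z

theorem sum_fin_succ_fun (j : ℕ) (F : (Fin (j + 1) → V) → ℝ) :
    ∑ Q, F Q = ∑ x : V, ∑ Q : Fin j → V, F (Fin.cons x Q) := by
  rw [← (Fin.consEquiv fun _ : Fin (j + 1) => V).sum_comp, Fintype.sum_prod_type]
  rfl

-- An injective sequence never returns to its predecessor, so it is one of the non-backtracking
-- walks; the weights are nonnegative, so the others may be added. The predecessor y is part of the
-- injectivity condition to make the induction close.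
open scoped Classical in
theorem injective_sum_le_nbSum (H : SimpleGraph V) {b : ℝ} (hb : 0 ≤ b) (j : ℕ) (y x : V) :
    ∑ Q : Fin j → V, (if Function.Injective (Fin.cons y (Fin.cons x Q : Fin (j + 1) → V) :
        Fin (j + 2) → V) then
      ∏ i : Fin j, (if H.Adj ((Fin.cons x Q : Fin (j + 1) → V) i.castSucc)
        ((Fin.cons x Q : Fin (j + 1) → V) i.succ) then b else 1) else 0) ≤
      nbSum H b j (some y) x := by
  induction j generalizing y x with
  | zero =>
    simp only [Finset.univ_unique, Finset.sum_singleton, Finset.univ_eq_empty, Finset.prod_empty,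
      nbSum]
    split_ifs <;> norm_num
  | succ j ih =>
    rw [nbSum, sum_fin_succ_fun]
    refine Finset.sum_le_sum fun z _ => ?_
    by_cases hzy : some z = some y
    · rw [if_pos hzy]
      refine le_of_eq (Finset.sum_eq_zero fun Q _ => ?_)
      rw [if_neg]
      intro hinj
      exact absurd (@hinj 0 (Fin.succ (Fin.succ 0)) (Option.some.inj hzy).symm)
        (Fin.succ_ne_zero _).symm
    · rw [if_neg hzy]
      refine le_trans ?_ (mul_le_mul_of_nonneg_left (ih x z) (by split_ifs <;> positivity))
      rw [Finset.mul_sum]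
      refine Finset.sum_le_sum fun Q _ => ?_
      rw [mul_ite, mul_zero, Fin.prod_univ_succ]
      by_cases hinj : Function.Injective (Fin.cons y
        (Fin.cons x (Fin.cons z Q : Fin (j + 1) → V) : Fin (j + 2) → V) : Fin (j + 3) → V)
      · have hinj' := (Fin.cons_injective_iff.1 hinj).2
        rw [if_pos hinj, if_pos hinj']
        apply le_of_eq
        rfl
      · rw [if_neg hinj]
        split_ifs
        · exact mul_nonneg hb (Finset.prod_nonneg fun i _ => by split_ifs <;> positivity)
        · exact mul_nonneg zero_le_one
            (Finset.prod_nonneg fun i _ => by split_ifs <;> positivity)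
        · rfl

open scoped Classical in
theorem injective_sum_le_nbSum_none (H : SimpleGraph V) {b : ℝ} (hb : 0 ≤ b) (j : ℕ) :
    ∑ Q : Fin (j + 1) → V, (if Function.Injective Q then
      ∏ i : Fin j, (if H.Adj (Q i.castSucc) (Q i.succ) then b else 1) else 0) ≤
      ∑ x, nbSum H b j none x := by
  rw [sum_fin_succ_fun]
  refine Finset.sum_le_sum fun x _ => ?_
  cases j with
  | zero =>
    simp only [Finset.univ_unique, Finset.sum_singleton, Finset.univ_eq_empty, Finset.prod_empty,
      nbSum]
    split_ifs <;> norm_num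
  | succ j =>
    rw [nbSum, sum_fin_succ_fun]
    refine Finset.sum_le_sum fun z _ => ?_
    rw [if_neg (by simp)]
    refine le_trans ?_ (mul_le_mul_of_nonneg_left (injective_sum_le_nbSum H hb j x z)
      (by split_ifs <;> positivity))
    rw [Finset.mul_sum]
    refine Finset.sum_le_sum fun Q _ => ?_
    rw [mul_ite, mul_zero, Fin.prod_univ_succ]
    by_cases hinj : Function.Injective (Fin.cons x (Fin.cons z Q : Fin (j + 1) → V) :
        Fin (j + 2) → V)
    · rw [if_pos hinj, if_pos hinj]
      apply le_of_eq
      rfl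
    · rw [if_neg hinj, if_neg hinj]

-- The three bounds are proved by a joint induction on the number of steps. A step off `H` costs a
-- factor n, or nα once the at most K entries into U are charged with M. Steps along `H` add ρc for
-- each available neighbour: two in general (M = 1 + 2ρc), none outside U, and one just after an
-- `H`-step, since turning back is forbidden. In the last case the constant must reproduce itself,
-- whence 1 + ρc = c, the geometric series for a run along a path.
open scoped Classical in
theorem nbSum_le (H : SimpleGraph V) (U : Finset V) (hU : ∀ x z, H.Adj x z → z ∈ U)
    (hdeg : ∀ x, (H.neighborFinset x).card ≤ 2) {n K ρ c M α : ℝ} (hn : n = Fintype.card V)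
    (hn0 : 0 < n) (hK : (U.card : ℝ) = K) (hρ0 : 0 ≤ ρ) (hc0 : 1 ≤ c) (hc : 1 + ρ * c = c)
    (hM : M = 1 + 2 * (ρ * c)) (hα : α = 1 + K * M / n) (j : ℕ) (y : Option V) (x : V) :
    nbSum H (ρ * n) j y x ≤ n ^ j * α ^ j * M ∧
      (x ∉ U → nbSum H (ρ * n) j y x ≤ n ^ j * α ^ j) ∧
      (∀ y', y = some y' → H.Adj x y' → nbSum H (ρ * n) j y x ≤ n ^ j * α ^ j * c) := by
  have hρc : 0 ≤ ρ * c := by positivity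
  have hM1 : 1 ≤ M := by linarith
  have hK0 : 0 ≤ K := by rw [← hK]; positivity
  have hα1 : 1 ≤ α := by
    have : 0 ≤ K * M / n := by positivity
    linarith
  induction j generalizing y x with
  | zero => simpa [nbSum] using ⟨hM1, fun _ _ _ => hc0⟩
  | succ j ih =>
    set a := n ^ j * α ^ j with ha
    have ha0 : 0 < a := by positivity
    set T := (H.neighborFinset x).filter fun z => some z ≠ y with hT
    have hterm : ∀ z, (if some z = y then 0 else
        (if H.Adj x z then ρ * n else 1) * nbSum H (ρ * n) j (some x) z) ≤
        (a + if z ∈ U then a * M else 0) + if z ∈ T then ρ * n * (a * c) else 0 := by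
      intro z
      obtain ⟨ih1, ih2, ih3⟩ := ih (some x) z
      have hρa : 0 ≤ ρ * n * (a * c) := by positivity
      have haM : 0 ≤ a * M := by positivity
      by_cases hzy : some z = y
      · rw [if_pos hzy]
        refine add_nonneg (add_nonneg ha0.le ?_) ?_ <;> split_ifs <;> linarith
      · rw [if_neg hzy]
        by_cases hxz : H.Adj x z
        · have hzT : z ∈ T := by simp [hT, hxz, hzy]
          rw [if_pos hxz, if_pos hzT, if_pos (hU x z hxz)]
          have := mul_le_mul_of_nonneg_left (ih3 x rfl hxz.symm)
            (show 0 ≤ ρ * n by positivity)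
          linarith
        · have hzT : z ∉ T := by simp [hT, hxz]
          rw [if_neg hxz, if_neg hzT, one_mul, add_zero]
          split_ifs with hz
          · linarith
          · simpa using ih2 hz
    have hsum : nbSum H (ρ * n) (j + 1) y x ≤
        n ^ (j + 1) * α ^ (j + 1) + T.card * (ρ * c * (n * a)) := by
      -- Entering U is charged a + aM instead of aM, so that the first two terms sum to exactly n a
      -- α.
      rw [nbSum]
      refine (Finset.sum_le_sum fun z _ => hterm z).trans ?_
      rw [Finset.sum_add_distrib, Finset.sum_add_distrib, Finset.sum_ite_mem, Finset.sum_ite_mem,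
        Finset.univ_inter, Finset.univ_inter]
      simp only [Finset.sum_const, Finset.card_univ, nsmul_eq_mul, ← hn, hK]
      have h1 : n * a + K * (a * M) = n ^ (j + 1) * α ^ (j + 1) := by
        rw [pow_succ, pow_succ α, ha]
        nth_rw 4 [hα]
        field_simp
      rw [h1]
      apply le_of_eq
      ring
    have hna : n * a ≤ n ^ (j + 1) * α ^ (j + 1) := by
      have : n ^ (j + 1) * α ^ (j + 1) = n * a * α := by rw [ha]; ring
      rw [this]
      exact le_mul_of_one_le_right (by positivity) hα1
    have hbd : ∀ r : ℝ, (T.card : ℝ) ≤ r → nbSum H (ρ * n) (j + 1) y x ≤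
        n ^ (j + 1) * α ^ (j + 1) * (1 + r * (ρ * c)) := by
      intro r hr
      have hr0 : 0 ≤ r := (Nat.cast_nonneg _).trans hr
      have h1 : (T.card : ℝ) * (ρ * c * (n * a)) ≤
          r * (ρ * c * (n ^ (j + 1) * α ^ (j + 1))) := by gcongr
      linarith
    refine ⟨?_, fun hx => ?_, ?_⟩
    · rw [hM]
      refine hbd 2 ?_
      have : T.card ≤ 2 := (Finset.card_filter_le _ _).trans (hdeg x)
      exact_mod_cast this
    · have hT0 : T = ∅ := by
        refine Finset.eq_empty_of_forall_notMem fun z hz => hx ?_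
        simp only [hT, Finset.mem_filter, SimpleGraph.mem_neighborFinset] at hz
        exact hU z x hz.1.symm
      simpa using hbd 0 (by simp [hT0])
    · rintro y' rfl hy'
      have h2 := hbd 1 ?_
      · rwa [one_mul, hc] at h2
      · have hss : T ⊂ H.neighborFinset x := by
          refine (Finset.ssubset_iff_of_subset (Finset.filter_subset _ _)).2 ⟨y', by simpa, ?_⟩
          simp
        have := Finset.card_lt_card hss
        have : T.card ≤ 1 := by have := hdeg x; omega
        exact_mod_cast this

end NonBacktracking

/-! ### Second moment method for long paths -/

section LongPath

variable {V : Type*}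

open scoped Classical in
/-- The edges of the path `Q 0, Q 1, …`. -/
noncomputable def pathEdges {k : ℕ} (Q : Fin (k + 1) → V) : Finset (Sym2 V) :=
  Finset.univ.image fun i : Fin k => s(Q i.castSucc, Q i.succ)

theorem pathEdges_injective {k : ℕ} {Q : Fin (k + 1) → V} (hQ : Function.Injective Q) :
    Function.Injective fun i : Fin k => s(Q i.castSucc, Q i.succ) := by
  intro i j hij
  rcases Sym2.eq_iff.1 hij with ⟨h, _⟩ | ⟨h, h'⟩
  · exact Fin.castSucc_injective _ (hQ h)
  · have h := congrArg Fin.val (hQ h)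
    have h' := congrArg Fin.val (hQ h')
    simp at h h'
    omega

theorem card_pathEdges {k : ℕ} {Q : Fin (k + 1) → V} (hQ : Function.Injective Q) :
    (pathEdges Q).card = k := by
  classical
  rw [pathEdges, Finset.card_image_of_injective _ (pathEdges_injective hQ), Finset.card_univ,
    Fintype.card_fin]

theorem pathEdges_subset_pairs [Fintype V] {k : ℕ} {Q : Fin (k + 1) → V}
    (hQ : Function.Injective Q) : pathEdges Q ⊆ pairs V := by
  classical
  intro e he
  obtain ⟨i, _, rfl⟩ := Finset.mem_image.1 he
  rw [mem_pairs, Sym2.mk_isDiag_iff]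
  intro h
  have := congrArg Fin.val (hQ h)
  simp at this

theorem pathEdges_adj {k : ℕ} {Q : Fin (k + 1) → V} {x z : V}
    (h : (SimpleGraph.fromEdgeSet (pathEdges Q : Set (Sym2 V))).Adj x z) :
    ∃ i j : Fin (k + 1), x = Q i ∧ z = Q j ∧ (j.val + 1 = i.val ∨ j.val = i.val + 1) := by
  classical
  rw [SimpleGraph.fromEdgeSet_adj] at h
  obtain ⟨i, _, hi⟩ := Finset.mem_image.1 (Finset.mem_coe.1 h.1)
  rcases Sym2.eq_iff.1 hi with ⟨rfl, rfl⟩ | ⟨rfl, rfl⟩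
  · exact ⟨_, _, rfl, rfl, by simp⟩
  · exact ⟨_, _, rfl, rfl, by simp⟩

open scoped Classical in
theorem pathEdges_degree [Fintype V] {k : ℕ} {P : Fin (k + 1) → V} (hP : Function.Injective P)
    {H : SimpleGraph V} (hH : H = SimpleGraph.fromEdgeSet (pathEdges P : Set (Sym2 V))) (x : V) :
    (H.neighborFinset x).card ≤ 2 := by
  have hadj : ∀ x z, H.Adj x z → ∃ i j : Fin (k + 1), x = P i ∧ z = P j ∧
      (j.val + 1 = i.val ∨ j.val = i.val + 1) := fun x z h => pathEdges_adj (hH ▸ h)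
  by_cases hx : ∃ i, x = P i
  · obtain ⟨i, rfl⟩ := hx
    have h1 : H.neighborFinset (P i) ⊆
        (Finset.univ.filter fun j : Fin (k + 1) => j.val + 1 = i.val ∨ j.val = i.val + 1).image
          P := by
      intro z hz
      obtain ⟨i', j, hi, rfl, hj⟩ := hadj _ _ ((H.mem_neighborFinset _ _).1 hz)
      rw [← hP hi] at hj
      exact Finset.mem_image_of_mem P (by simpa using hj)
    refine (Finset.card_le_card h1).trans (Finset.card_image_le.trans ?_)
    refine (Finset.card_le_card_of_injOn Fin.val
      (t := {i.val - 1, i.val + 1}) ?_ Fin.val_injective.injOn).trans Finset.card_le_two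
    intro j hj
    simp only [Finset.coe_filter, Finset.mem_univ, true_and, Set.mem_ofPred_eq] at hj
    simp only [Finset.coe_insert, Finset.coe_singleton, Set.mem_insert_iff,
      Set.mem_singleton_iff]
    omega
  · have : H.neighborFinset x = ∅ := by
      refine Finset.eq_empty_of_forall_notMem fun z hz => hx ?_
      obtain ⟨i, j, hi, _⟩ := hadj _ _ ((H.mem_neighborFinset _ _).1 hz)
      exact ⟨i, hi⟩
    rw [this]
    simp

-- For fixed P, let `H` be the graph of its edges. Each common edge of Q and P is a step of Q along
-- `H`, so the sum is a non-backtracking count with step weight ρn. The choice c = 1/(1-ρ) needs ρ <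
-- 1.
open scoped Classical in
theorem sum_pathEdges_le [Fintype V] {k : ℕ} {P : Fin (k + 1) → V} (hP : Function.Injective P)
    {n ρ M α : ℝ} (hn : n = Fintype.card V) (hρ0 : 0 ≤ ρ) (hρ1 : ρ < 1)
    (hM : M = 1 + 2 * (ρ / (1 - ρ))) (hα : α = 1 + (k + 1) * M / n) :
    ∑ Q : Fin (k + 1) → V, (if Function.Injective Q then
      (ρ * n) ^ (pathEdges Q ∩ pathEdges P).card else 0) ≤ n ^ (k + 1) * α ^ (k + 1) := by
  have hV : Nonempty V := ⟨P 0⟩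
  have hn0 : 0 < n := by rw [hn]; exact_mod_cast Fintype.card_pos
  obtain ⟨H, hH⟩ : ∃ H, H = SimpleGraph.fromEdgeSet (pathEdges P : Set (Sym2 V)) := ⟨_, rfl⟩
  set U : Finset V := Finset.univ.image P with hUdef
  have h1ρ : 0 < 1 - ρ := by linarith
  have hU : ∀ x z, H.Adj x z → z ∈ U := fun x z h => by
    obtain ⟨i, j, _, rfl, _⟩ := pathEdges_adj (hH ▸ h)
    simp [hUdef]
  have hdeg : ∀ x, (H.neighborFinset x).card ≤ 2 := pathEdges_degree hP hH
  have hUc : (U.card : ℝ) = k + 1 := by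
    rw [hUdef, Finset.card_image_of_injective _ hP, Finset.card_univ, Fintype.card_fin]
    push_cast
    rfl
  have hnb := nbSum_le H U hU hdeg (n := n) (K := k + 1) (ρ := ρ) (c := 1 / (1 - ρ)) (M := M)
    (α := α) hn hn0 hUc hρ0 (by rw [le_div_iff₀ h1ρ]; linarith) (by field_simp; ring)
    (by rw [hM, mul_one_div]) hα k none
  have hb : 0 ≤ ρ * n := by positivity
  have hM0 : 0 ≤ M := by rw [hM]; positivity
  have hα0 : 0 ≤ α := by rw [hα]; positivity
  have hstep : ∀ Q : Fin (k + 1) → V, Function.Injective Q →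
      (ρ * n) ^ (pathEdges Q ∩ pathEdges P).card =
        ∏ i : Fin k, (if H.Adj (Q i.castSucc) (Q i.succ) then ρ * n else 1) := by
    intro Q hQ
    rw [← Finset.prod_const, ← Finset.prod_ite_mem, pathEdges,
      Finset.prod_image (pathEdges_injective hQ).injOn]
    refine Finset.prod_congr rfl fun i _ => ?_
    have hne : Q i.castSucc ≠ Q i.succ := fun h => by
      have := congrArg Fin.val (hQ h)
      simp at this
    simp [hH, hne]
  calc _ = ∑ Q : Fin (k + 1) → V, (if Function.Injective Q then
          ∏ i : Fin k, (if H.Adj (Q i.castSucc) (Q i.succ) then ρ * n else 1) else 0) :=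
        Finset.sum_congr rfl fun Q _ => by
          by_cases hQ : Function.Injective Q
          · rw [if_pos hQ, if_pos hQ, hstep Q hQ]
          · rw [if_neg hQ, if_neg hQ]
    _ ≤ ∑ x, nbSum H (ρ * n) k none x := injective_sum_le_nbSum_none H hb k
    _ ≤ ∑ x, (n ^ k * α ^ k + if x ∈ U then n ^ k * α ^ k * M else 0) := by
        refine Finset.sum_le_sum fun x _ => ?_
        obtain ⟨h1, h2, -⟩ := hnb x
        split_ifs with hx
        · have : 0 ≤ n ^ k * α ^ k := by positivity
          linarith
        · simpa using h2 hx
    _ = n ^ (k + 1) * α ^ (k + 1) := by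
        rw [Finset.sum_add_distrib, Finset.sum_ite_mem, Finset.univ_inter]
        simp only [Finset.sum_const, Finset.card_univ, nsmul_eq_mul, ← hn, hUc]
        rw [pow_succ, pow_succ α]
        nth_rw 4 [hα]
        field_simp

open scoped Classical in
/-- A path with `k` edges exists with probability close to `1` when `k ^ 2` is small compared to
the number of vertices and the mean degree exceeds `1`. -/
theorem prob_no_path [Fintype V] {k : ℕ} {p n ρ M α η : ℝ} (h0 : 0 < p) (h1 : p ≤ 1)
    (hn : n = Fintype.card V) (hkn : k + 1 ≤ Fintype.card V) (hρ : ρ * n = 1 / p) (hρ1 : ρ < 1)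
    (hM : M = 1 + 2 * (ρ / (1 - ρ))) (hα : α = 1 + (k + 1) * M / n)
    (hη : n ^ (k + 1) * α ^ (k + 1) ≤ (1 + η) * ((Fintype.card V).descFactorial (k + 1) : ℕ)) :
    prob p {G : SimpleGraph V | ¬ ∃ Q : Fin (k + 1) → V, Function.Injective Q ∧
      ∀ i : Fin k, G.Adj (Q i.castSucc) (Q i.succ)} ≤ η := by
  set N : ℝ := Nat.cast (R := ℝ) ((Fintype.card V).descFactorial (k + 1)) with hN
  have hN0 : 0 < N := by
    rw [hN]
    exact_mod_cast Nat.descFactorial_pos.2 hkn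
  have hn0 : 0 < n := by rw [hn]; exact_mod_cast (by omega : 0 < Fintype.card V)
  have hρ0 : 0 ≤ ρ := by
    have : 0 < ρ * n := by rw [hρ]; positivity
    exact (pos_of_mul_pos_left this hn0.le).le
  set X : SimpleGraph V → ℝ := fun G => ∑ Q : Fin (k + 1) → V,
    if Function.Injective Q then (if pathEdges Q ⊆ G.edgeFinset then 1 else 0) else 0 with hX
  have hcount : ∑ Q : Fin (k + 1) → V, (if Function.Injective Q then (1 : ℝ) else 0) = N := by
    rw [← Finset.sum_filter, Finset.sum_const, nsmul_eq_mul, mul_one, hN]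
    congr 1
    rw [← Fintype.card_subtype, Fintype.card_congr (Equiv.subtypeInjectiveEquivEmbedding _ _),
      Fintype.card_embedding_eq, Fintype.card_fin]
  have hone : ∀ A : Finset (Sym2 V), A ⊆ pairs V →
      ∑ G : SimpleGraph V, weight p G * (if A ⊆ G.edgeFinset then 1 else 0) = p ^ A.card := by
    intro A hA
    simpa using sum_weight_edges p hA (Finset.empty_subset _) (Finset.disjoint_empty_right _)
  -- X counts paths with k edges as vertex sequences; with δ = 1 the lower tail event is X ≤ 0, no
  -- path at all.
  have hcheb := prob_chebyshev h0.le h1 X (m := N * p ^ k) (η := η) (δ := 1) (by positivity)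
    one_pos ?_ ?_
  · rw [one_pow, div_one, sub_self, zero_mul] at hcheb
    refine (prob_mono h0.le h1 ?_).trans hcheb
    intro G hG
    simp only [Set.mem_ofPred_eq]
    refine le_of_eq (Finset.sum_eq_zero fun Q _ => ?_)
    by_cases hQ : Function.Injective Q
    · rw [if_pos hQ, if_neg]
      intro hsub
      refine hG ⟨Q, hQ, fun i => ?_⟩
      have : s(Q i.castSucc, Q i.succ) ∈ G.edgeFinset :=
        hsub (Finset.mem_image_of_mem _ (Finset.mem_univ i))
      simpa using this
    · rw [if_neg hQ]
  · simp only [hX, Finset.mul_sum]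
    rw [Finset.sum_comm (s := (Finset.univ : Finset (SimpleGraph V))), ← hcount, Finset.sum_mul]
    refine Finset.sum_congr rfl fun Q _ => ?_
    by_cases hQ : Function.Injective Q
    · simp only [if_pos hQ]
      rw [hone _ (pathEdges_subset_pairs hQ), card_pathEdges hQ, one_mul]
    · simp [hQ]
  · simp only [hX, pow_two, Finset.sum_mul_sum]
    simp only [Finset.mul_sum]
    rw [Finset.sum_comm (s := (Finset.univ : Finset (SimpleGraph V)))]
    have hP : ∀ P : Fin (k + 1) → V, ∑ Q : Fin (k + 1) → V, ∑ G : SimpleGraph V, weight p G *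
        ((if Function.Injective P then (if pathEdges P ⊆ G.edgeFinset then 1 else 0) else 0) *
          (if Function.Injective Q then (if pathEdges Q ⊆ G.edgeFinset then 1 else 0) else 0)) ≤
        (if Function.Injective P then 1 else 0) * (p ^ k * p ^ k * ((1 + η) * N)) := by
      intro P
      by_cases hP : Function.Injective P
      · simp only [if_pos hP, one_mul]
        refine le_trans ?_ (mul_le_mul_of_nonneg_left
          ((sum_pathEdges_le hP hn hρ0 hρ1 hM hα).trans hη) (by positivity))
        rw [Finset.mul_sum]
        refine Finset.sum_le_sum fun Q _ => ?_
        by_cases hQ : Function.Injective Q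
        · simp only [if_pos hQ]
          have h2 := hone _ (Finset.union_subset (pathEdges_subset_pairs hP)
            (pathEdges_subset_pairs hQ))
          have h3 := Finset.card_union_add_card_inter (pathEdges P) (pathEdges Q)
          rw [card_pathEdges hP, card_pathEdges hQ, Finset.inter_comm] at h3
          -- Each shared edge is paid for once instead of twice, a gain of 1/p = ρn.
          have h4 : p ^ k * p ^ k * (ρ * n) ^ (pathEdges Q ∩ pathEdges P).card =
              p ^ (pathEdges P ∪ pathEdges Q).card := by
            rw [← pow_add, ← h3, pow_add, hρ, mul_assoc, ← mul_pow, mul_one_div_cancel h0.ne',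
              one_pow, mul_one]
          rw [h4, ← h2]
          apply le_of_eq
          refine Finset.sum_congr rfl fun G _ => ?_
          simp only [Finset.union_subset_iff]
          by_cases ha : pathEdges P ⊆ G.edgeFinset <;>
            by_cases hb : pathEdges Q ⊆ G.edgeFinset <;> simp [ha, hb]
        · simp [hQ]
      · simp [hP]
    refine (Finset.sum_le_sum fun P _ =>
      (Finset.sum_comm (s := (Finset.univ : Finset (SimpleGraph V)))).trans_le (hP P)).trans ?_
    rw [← Finset.sum_mul, hcount]
    apply le_of_eq
    ring

end LongPath

/-! ### Attaching a path of isolated vertices, and recovering it -/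

section Attach

variable {V : Type*}

/-- The vertices reachable from `x`. -/
def reachSet (G : SimpleGraph V) (x : V) : Set V := {y | G.Reachable x y}

theorem mem_of_reachable {G : SimpleGraph V} {S : Set V} (hS : ∀ x ∈ S, ∀ y, G.Adj x y → y ∈ S)
    {x y : V} (hx : x ∈ S) (h : G.Reachable x y) : y ∈ S := by
  obtain ⟨w⟩ := h
  induction w with
  | nil => exact hx
  | cons hadj _ ih => exact ih (hS _ hx _ hadj)

theorem reachSet_eq {G : SimpleGraph V} {x y : V} (h : G.Reachable x y) :
    reachSet G x = reachSet G y :=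
  Set.ext fun _ => ⟨fun hz => h.symm.trans hz, fun hz => h.trans hz⟩

/-- No path with `L` edges in the component of `x` has interior vertices without further
neighbours. -/
def BareFree (G : SimpleGraph V) (x : V) (L : ℕ) : Prop :=
  ¬ ∃ h : ℕ → V, Set.InjOn h (Set.Iic L) ∧ G.Reachable x (h 0) ∧
    (∀ i < L, G.Adj (h i) (h (i + 1))) ∧
    ∀ i, 0 < i → i < L → ∀ y, G.Adj (h i) y → y = h (i - 1) ∨ y = h (i + 1)

/-- The graph `G` with the path `g 0, …, g L` added. -/
def attachPath (G : SimpleGraph V) (g : ℕ → V) (L : ℕ) : SimpleGraph V :=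
  G ⊔ SimpleGraph.fromEdgeSet {e | ∃ i < L, e = s(g i, g (i + 1))}

/-- The path `g 0, …, g L` consists of isolated vertices apart from `g 0`, and `g 0` lies in a
largest component, which has more than `L` vertices and no long path with bare interior. -/
structure Attachable (G : SimpleGraph V) (g : ℕ → V) (L : ℕ) : Prop where
  pos : 0 < L
  inj : Set.InjOn g (Set.Iic L)
  isolated : ∀ i, 0 < i → i ≤ L → ∀ y, ¬ G.Adj (g i) y
  large : L < (reachSet G (g 0)).ncard
  largest : ∀ x, (reachSet G x).ncard ≤ (reachSet G (g 0)).ncard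
  free : BareFree G (g 0) L

namespace Attachable

variable {G : SimpleGraph V} {g : ℕ → V} {L : ℕ}

theorem eq_of_eq (S : Attachable G g L) {i j : ℕ} (hi : i ≤ L) (hj : j ≤ L) (h : g i = g j) :
    i = j := S.inj (Set.mem_Iic.2 hi) (Set.mem_Iic.2 hj) h

theorem adj_iff (S : Attachable G g L) {x y : V} : (attachPath G g L).Adj x y ↔
    G.Adj x y ∨ ∃ i < L, x = g i ∧ y = g (i + 1) ∨ x = g (i + 1) ∧ y = g i := by
  simp only [attachPath, SimpleGraph.sup_adj, SimpleGraph.fromEdgeSet_adj, Set.mem_ofPred_eq,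
    Sym2.eq_iff]
  constructor
  · rintro (h | ⟨h, -⟩)
    · exact Or.inl h
    · exact Or.inr h
  · rintro (h | ⟨i, hi, h⟩)
    · exact Or.inl h
    · refine Or.inr ⟨⟨i, hi, h⟩, ?_⟩
      rintro rfl
      have : g i = g (i + 1) := by rcases h with ⟨h1, h2⟩ | ⟨h1, h2⟩ <;> rw [← h1, ← h2]
      have := S.eq_of_eq (by omega) (by omega) this
      omega

theorem adj_succ (S : Attachable G g L) {i : ℕ} (hi : i < L) :
    (attachPath G g L).Adj (g i) (g (i + 1)) :=
  S.adj_iff.2 (Or.inr ⟨i, hi, Or.inl ⟨rfl, rfl⟩⟩)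

theorem eq_of_adj (S : Attachable G g L) {j : ℕ} (hj0 : 0 < j) (hj : j ≤ L) {y : V}
    (h : (attachPath G g L).Adj (g j) y) : y = g (j - 1) ∨ j < L ∧ y = g (j + 1) := by
  rcases S.adj_iff.1 h with h | ⟨i, hi, ⟨h1, rfl⟩ | ⟨h1, rfl⟩⟩
  · exact absurd h (S.isolated j hj0 hj y)
  · obtain rfl := S.eq_of_eq hj (by omega) h1
    exact Or.inr ⟨hi, rfl⟩
  · obtain rfl := S.eq_of_eq hj (by omega) h1
    exact Or.inl rfl

/-- The vertices that are attached. -/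
def tail (g : ℕ → V) (L : ℕ) : Set V := {x | ∃ j, 0 < j ∧ j ≤ L ∧ x = g j}

theorem adj_of_notMem (S : Attachable G g L) {x y : V} (h : (attachPath G g L).Adj x y)
    (hx : x ∉ tail g L) (hy : y ∉ tail g L) : G.Adj x y := by
  rcases S.adj_iff.1 h with h | ⟨i, hi, ⟨h1, rfl⟩ | ⟨rfl, h1⟩⟩
  · exact h
  · exact absurd ⟨i + 1, by omega, by omega, rfl⟩ hy
  · exact absurd ⟨i + 1, by omega, by omega, rfl⟩ hx

theorem notMem_of_adj (S : Attachable G g L) {x y : V} (h : G.Adj x y) : x ∉ tail g L := by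
  rintro ⟨j, hj0, hj, rfl⟩
  exact S.isolated j hj0 hj y h

theorem adj_iff_of_attach (S : Attachable G g L) {x y : V} :
    G.Adj x y ↔ (attachPath G g L).Adj x y ∧ x ∉ tail g L ∧ y ∉ tail g L :=
  ⟨fun h => ⟨S.adj_iff.2 (Or.inl h), S.notMem_of_adj h, S.notMem_of_adj h.symm⟩,
    fun h => S.adj_of_notMem h.1 h.2.1 h.2.2⟩

theorem le_attach (G : SimpleGraph V) (g : ℕ → V) (L : ℕ) : G ≤ attachPath G g L := le_sup_left

theorem reachSet_attach (S : Attachable G g L) :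
    reachSet (attachPath G g L) (g 0) = reachSet G (g 0) ∪ tail g L := by
  apply Set.Subset.antisymm
  · intro y hy
    refine mem_of_reachable (S := reachSet G (g 0) ∪ tail g L) ?_
      (Or.inl (SimpleGraph.Reachable.refl _)) hy
    rintro x hx y hxy
    by_cases hyt : y ∈ tail g L
    · exact Or.inr hyt
    by_cases hxt : x ∈ tail g L
    · obtain ⟨j, hj0, hj, rfl⟩ := hxt
      rcases S.eq_of_adj hj0 hj hxy with rfl | ⟨hjL, rfl⟩
      · obtain rfl | h : j = 1 ∨ 0 < j - 1 := by omega
        · exact Or.inl (SimpleGraph.Reachable.refl _)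
        · exact Or.inr ⟨j - 1, h, by omega, rfl⟩
      · exact Or.inr ⟨j + 1, by omega, by omega, rfl⟩
    · rcases hx with hx | hx
      · exact Or.inl (SimpleGraph.Reachable.trans hx (S.adj_of_notMem hxy hxt hyt).reachable)
      · exact absurd hx hxt
  · rintro y (hy | ⟨j, -, hj, rfl⟩)
    · exact SimpleGraph.Reachable.mono (le_attach G g L) hy
    · show (attachPath G g L).Reachable (g 0) (g j)
      induction j with
      | zero => rfl
      | succ j ih => exact (ih (by omega)).trans (S.adj_succ (by omega)).reachable

theorem tail_eq_image (g : ℕ → V) (L : ℕ) : tail g L = g '' (Set.Ioc 0 L) := by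
  ext x
  constructor
  · rintro ⟨j, h0, h1, rfl⟩
    exact ⟨j, ⟨h0, h1⟩, rfl⟩
  · rintro ⟨j, ⟨h0, h1⟩, rfl⟩
    exact ⟨j, h0, h1, rfl⟩

theorem ncard_tail (S : Attachable G g L) : (tail g L).ncard = L := by
  rw [tail_eq_image, (S.inj.mono fun i hi => hi.2).ncard_image,
    ← Finset.coe_Ioc, Set.ncard_coe_finset, Nat.card_Ioc, Nat.sub_zero]

theorem disjoint_tail (S : Attachable G g L) : Disjoint (reachSet G (g 0)) (tail g L) := by
  rw [Set.disjoint_left]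
  intro x hx hxt
  refine mem_of_reachable (G := G) (S := (tail g L)ᶜ) ?_ ?_ hx hxt
  · exact fun x _ y hxy => S.notMem_of_adj hxy.symm
  · rintro ⟨j, hj0, hj, h⟩
    have := S.eq_of_eq (by omega) hj h
    omega

theorem ncard_reachSet_attach [Finite V] (S : Attachable G g L) :
    (reachSet (attachPath G g L) (g 0)).ncard = (reachSet G (g 0)).ncard + L := by
  rw [S.reachSet_attach, Set.ncard_union_eq S.disjoint_tail, S.ncard_tail]

/-- Components away from the attached one are unchanged, hence no larger than the old largest
component. So the attached component is the unique largest one. -/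
theorem ncard_reachSet_le [Finite V] (S : Attachable G g L) {x : V}
    (hx : x ∉ reachSet (attachPath G g L) (g 0)) :
    (reachSet (attachPath G g L) x).ncard ≤ (reachSet G (g 0)).ncard := by
  refine le_trans (Set.ncard_le_ncard ?_) (S.largest x)
  intro y hy
  refine (mem_of_reachable (G := attachPath G g L)
    (S := reachSet G x \ reachSet (attachPath G g L) (g 0)) ?_
    ⟨SimpleGraph.Reachable.refl _, hx⟩ hy).1
  rintro z ⟨hz1, hz2⟩ w hzw
  have hw : w ∉ reachSet (attachPath G g L) (g 0) := fun hw =>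
    hz2 (SimpleGraph.Reachable.trans hw hzw.symm.reachable)
  have hnot : ∀ v, v ∉ reachSet (attachPath G g L) (g 0) → v ∉ tail g L := by
    intro v hv hvt
    rw [S.reachSet_attach] at hv
    exact hv (Or.inr hvt)
  exact ⟨SimpleGraph.Reachable.trans hz1
    (S.adj_of_notMem hzw (hnot z hz2) (hnot w hw)).reachable, hw⟩

variable {G₂ : SimpleGraph V} {h : ℕ → V}

/-- Otherwise each of the two attached components would exceed the other by at least L > 0 vertices.
-/
theorem reachable_of_eq [Finite V] (S : Attachable G g L) (T : Attachable G₂ h L)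
    (e : attachPath G g L = attachPath G₂ h L) : h 0 ∈ reachSet (attachPath G g L) (g 0) := by
  by_contra hn
  have h1 := S.ncard_reachSet_le hn
  rw [e, T.ncard_reachSet_attach] at h1
  have h2 := T.ncard_reachSet_le (x := g 0) fun h' => hn (by
    rw [← e] at h'
    exact SimpleGraph.Reachable.symm h')
  rw [← e, S.ncard_reachSet_attach] at h2
  have := S.pos
  omega

/-- Suppose the ends differ. The end of h has only one neighbour, so it is not an inner vertex of
the g-tail. If h avoids that tail altogether, it is a bare path already present in `G`,
contradicting `free`. Otherwise h leaves the tail for the last time from g 1 to g 0, and the whole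
component is covered by the rest of h and the tail: at most 2L vertices, contradicting `large`. -/
theorem last_eq [Finite V] (S : Attachable G g L) (T : Attachable G₂ h L)
    (e : attachPath G g L = attachPath G₂ h L) : g L = h L := by
  by_contra hne
  have hL := S.pos
  have hlast : h L ∉ tail g L := by
    rintro ⟨j, hj0, hj, hj'⟩
    obtain hjL | rfl : j < L ∨ j = L := by omega
    -- Here g j would have the two distinct neighbours g (j - 1) and g (j + 1).
    · have key : ∀ y, (attachPath G g L).Adj (g j) y → y = h (L - 1) := by
        intro y hy
        rw [← hj', e] at hy
        rcases T.eq_of_adj hL le_rfl hy with hy | hy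
        · exact hy
        · exact absurd hy.1 (lt_irrefl _)
      have h1 := key _ (S.adj_succ hjL)
      have hadj := S.adj_succ (i := j - 1) (by omega)
      rw [Nat.sub_add_cancel hj0] at hadj
      have h2 := key _ hadj.symm
      have := S.eq_of_eq (by omega) (by omega) (h1.trans h2.symm)
      omega
    · exact hne hj'.symm
  by_cases hall : ∀ i ≤ L, h i ∉ tail g L
  · refine S.free ⟨h, T.inj, ?_, fun i hi => ?_, fun i hi0 hi y hy => ?_⟩
    · have := S.reachable_of_eq T e
      rw [S.reachSet_attach] at this
      exact this.resolve_right (hall 0 (Nat.zero_le _))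
    · refine S.adj_of_notMem ?_ (hall i hi.le) (hall (i + 1) hi)
      rw [e]
      exact T.adj_succ hi
    · have hy' := le_attach G g L hy
      rw [e] at hy'
      exact (T.eq_of_adj hi0 hi.le hy').imp_right And.right
  · push Not at hall
    obtain ⟨i₀, hi₀, hi₀'⟩ := hall
    obtain ⟨i, hiL, hi, hmax⟩ : ∃ i, i < L ∧ h i ∈ tail g L ∧
        ∀ k, i < k → k ≤ L → h k ∉ tail g L := by
      classical
      set i := Nat.findGreatest (fun i => h i ∈ tail g L) L with hidef
      have hi : h i ∈ tail g L := Nat.findGreatest_spec (P := fun i => h i ∈ tail g L) hi₀ hi₀'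
      have hiL : i ≤ L := Nat.findGreatest_le L
      refine ⟨i, lt_of_le_of_ne hiL ?_, hi, fun k hk hkL =>
        Nat.findGreatest_is_greatest hk hkL⟩
      intro h'
      rw [h'] at hi
      exact hlast hi
    have hadj : (attachPath G g L).Adj (h i) (h (i + 1)) := by
      rw [e]
      exact T.adj_succ hiL
    have hnext := hmax (i + 1) (by omega) (by omega)
    obtain ⟨j, hj0, hj, hij⟩ := hi
    rw [hij] at hadj
    have hstart : j = 1 ∧ h (i + 1) = g 0 := by
      rcases S.eq_of_adj hj0 hj hadj with h1 | ⟨hjL, h1⟩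
      · by_cases hj1 : j = 1
        · subst hj1
          exact ⟨rfl, h1⟩
        · exact absurd ⟨j - 1, by omega, by omega, h1⟩ hnext
      · exact absurd ⟨j + 1, by omega, by omega, h1⟩ hnext
    obtain ⟨rfl, hstart⟩ := hstart
    have hsub : reachSet (attachPath G g L) (g 0) ⊆ h '' (Set.Ioc i L) ∪ tail g L := by
      intro y hy
      refine mem_of_reachable (S := h '' (Set.Ioc i L) ∪ tail g L) ?_
        (Or.inl ⟨i + 1, ⟨by omega, by omega⟩, hstart⟩) hy
      rintro x (⟨k, ⟨hk1, hk2⟩, rfl⟩ | ⟨j, hj0, hj, rfl⟩) y hxy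
      · rw [e] at hxy
        rcases T.eq_of_adj (by omega) hk2 hxy with rfl | ⟨hkL, rfl⟩
        · by_cases hk : k = i + 1
          · subst hk
            exact Or.inr ⟨1, one_pos, hL, hij⟩
          · exact Or.inl ⟨k - 1, ⟨by omega, by omega⟩, rfl⟩
        · exact Or.inl ⟨k + 1, ⟨by omega, by omega⟩, rfl⟩
      · rcases S.eq_of_adj hj0 hj hxy with rfl | ⟨hjL, rfl⟩
        · by_cases hj1 : j = 1
          · subst hj1
            exact Or.inl ⟨i + 1, ⟨by omega, by omega⟩, hstart⟩
          · exact Or.inr ⟨j - 1, by omega, by omega, rfl⟩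
        · exact Or.inr ⟨j + 1, by omega, by omega, rfl⟩
    have h1 := Set.ncard_le_ncard hsub
    have h2 := Set.ncard_union_le (h '' (Set.Ioc i L)) (tail g L)
    have h3 : (h '' (Set.Ioc i L)).ncard ≤ L := by
      refine (Set.ncard_image_le (Set.finite_Ioc i L)).trans ?_
      rw [← Finset.coe_Ioc, Set.ncard_coe_finset, Nat.card_Ioc]
      omega
    rw [S.ncard_tail] at h2
    rw [S.ncard_reachSet_attach] at h1
    have := S.large
    omega

/-- Both paths are traced back from the common end: the next vertex of h is a neighbour of the
current vertex of g, and it cannot be the one just visited because h is injective. -/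
theorem path_eq [Finite V] (S : Attachable G g L) (T : Attachable G₂ h L)
    (e : attachPath G g L = attachPath G₂ h L) {i : ℕ} (hi : i ≤ L) : g i = h i := by
  obtain ⟨t, rfl⟩ : ∃ t, i = L - t := ⟨L - i, by omega⟩
  induction t using Nat.strong_induction_on with
  | _ t ih =>
    rcases Nat.eq_zero_or_pos t with rfl | ht
    · exact S.last_eq T e
    by_cases htL : L < t
    · have := ih L htL (by omega)
      rwa [show L - t = L - L by omega]
    have h1 := ih (t - 1) (by omega) (by omega)
    have hadj := T.adj_succ (i := L - t) (by omega)
    rw [← e, show L - t + 1 = L - (t - 1) by omega, ← h1] at hadj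
    rcases S.eq_of_adj (by omega) (by omega) hadj.symm with h2 | ⟨h2, h3⟩
    · rw [h2]
      congr 1
      omega
    · have h4 := ih (t - 2) (by omega) (by omega)
      rw [show L - (t - 1) + 1 = L - (t - 2) by omega, h4] at h3
      have := T.eq_of_eq (by omega) (by omega) h3
      omega

/-- The tails agree, and the original graph is the attached one with all edges at the tail removed.
-/
theorem graph_eq [Finite V] (S : Attachable G g L) (T : Attachable G₂ h L)
    (e : attachPath G g L = attachPath G₂ h L) : G = G₂ := by
  have ht : tail g L = tail h L := by
    ext x
    constructor
    · rintro ⟨j, h0, h1, rfl⟩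
      exact ⟨j, h0, h1, S.path_eq T e h1⟩
    · rintro ⟨j, h0, h1, rfl⟩
      exact ⟨j, h0, h1, (S.path_eq T e h1).symm⟩
  ext x y
  rw [S.adj_iff_of_attach, T.adj_iff_of_attach, e, ht]

/-- The L added pairs are distinct and absent from `G`; each exchanges a factor 1 - p for p. -/
theorem weight_attach [Fintype V] (S : Attachable G g L) {p : ℝ} (hp : p < 1) :
    weight p (attachPath G g L) = weight p G * (p / (1 - p)) ^ L := by
  classical
  have hq : 1 - p ≠ 0 := by linarith
  have hE : (attachPath G g L).edgeFinset =
      G.edgeFinset ∪ (Finset.range L).image fun i => s(g i, g (i + 1)) := by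
    ext e
    induction e with | _ x y =>
    simp only [SimpleGraph.mem_edgeFinset, SimpleGraph.mem_edgeSet, S.adj_iff, Finset.mem_union,
      Finset.mem_image, Finset.mem_range, Sym2.eq_iff]
    refine or_congr_right (exists_congr fun i => and_congr_right fun _ => ?_)
    constructor
    · rintro (⟨rfl, rfl⟩ | ⟨rfl, rfl⟩) <;> simp
    · rintro (⟨rfl, rfl⟩ | ⟨rfl, rfl⟩) <;> simp
  have hdisj : Disjoint G.edgeFinset ((Finset.range L).image fun i => s(g i, g (i + 1))) := by
    rw [Finset.disjoint_left]
    intro e he he'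
    obtain ⟨i, hi, rfl⟩ := Finset.mem_image.1 he'
    have hadj : G.Adj (g i) (g (i + 1)) := by simpa using he
    exact S.isolated (i + 1) (by omega) (Finset.mem_range.1 hi) _ hadj.symm
  have hinj : Set.InjOn (fun i => s(g i, g (i + 1))) (Finset.range L : Set ℕ) := by
    intro i hi j hj hij
    have hi := Finset.mem_range.1 (Finset.mem_coe.1 hi)
    have hj := Finset.mem_range.1 (Finset.mem_coe.1 hj)
    rcases Sym2.eq_iff.1 hij with ⟨h1, _⟩ | ⟨h1, h2⟩
    · exact S.eq_of_eq hi.le hj.le h1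
    · have h1 := S.eq_of_eq (by omega) (by omega) h1
      have h2 := S.eq_of_eq (by omega) (by omega) h2
      omega
  have hcard : (attachPath G g L).edgeFinset.card = G.edgeFinset.card + L := by
    rw [hE, Finset.card_union_of_disjoint hdisj, Finset.card_image_of_injOn hinj,
      Finset.card_range]
  have hle := Finset.card_le_card (edgeFinset_subset_pairs (attachPath G g L))
  rw [hcard] at hle
  have hsub : (pairs V).card - G.edgeFinset.card =
      ((pairs V).card - (G.edgeFinset.card + L)) + L := by omega
  rw [weight, weight, hcard, hsub, pow_add, pow_add (1 - p), div_pow]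
  field_simp

end Attachable

end Attach

/-! ### The switching inequality -/

section Switching

variable {V : Type*} [Fintype V]

/-- The sequence `u, f 0, f 1, …`. -/
def consSeq {L : ℕ} (u : V) (f : Fin L → V) (i : ℕ) : V :=
  if h : 0 < i ∧ i ≤ L then f ⟨i - 1, by omega⟩ else u

omit [Fintype V] in
theorem consSeq_zero {L : ℕ} (u : V) (f : Fin L → V) : consSeq u f 0 = u := by simp [consSeq]

omit [Fintype V] in
theorem consSeq_succ {L : ℕ} (u : V) (f : Fin L → V) (i : Fin L) :
    consSeq u f (i + 1) = f i := by
  have : (i : ℕ) + 1 ≤ L := i.2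
  simp [consSeq, this]

/-- The graphs with many isolated vertices and with a large largest component without long bare
paths. -/
def deficient (V : Type*) [Fintype V] (L s m : ℕ) : Set (SimpleGraph V) :=
  {G | m ≤ isolatedCount G ∧ ∃ u, s ≤ (reachSet G u).ncard ∧
    (∀ x, (reachSet G x).ncard ≤ (reachSet G u).ncard) ∧ BareFree G u L}

/-- Attaching paths of isolated vertices to the largest component shows that it is unlikely to
have no long bare path. -/
theorem prob_deficient {p : ℝ} (h0 : 0 < p) (h1 : p < 1) {L s m : ℕ} (hL : 0 < L) (hs : L < s) :
    prob p (deficient V L s m) * (s * (m.descFactorial L : ℕ) * (p / (1 - p)) ^ L) ≤ 1 := by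
  classical
  have hq : 0 < 1 - p := by linarith
  have hr : 0 ≤ (p / (1 - p)) ^ L := by positivity
  -- All vertices of one suitable largest component serve as attachment points; a single component
  -- is fixed even when there are ties.
  have hroot : ∀ G : SimpleGraph V, ∃ U : Finset V, G ∈ deficient V L s m → s ≤ U.card ∧
      ∀ u ∈ U, s ≤ (reachSet G u).ncard ∧
        (∀ x, (reachSet G x).ncard ≤ (reachSet G u).ncard) ∧ BareFree G u L := by
    intro G
    by_cases hG : G ∈ deficient V L s m
    · obtain ⟨-, u, hu1, hu2, hu3⟩ := hG
      refine ⟨(reachSet G u).toFinset, fun _ => ⟨?_, fun x hx => ?_⟩⟩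
      · rwa [← Set.ncard_eq_toFinset_card']
      · have hx : G.Reachable u x := (Set.mem_toFinset (s := reachSet G u)).1 hx
        rw [← reachSet_eq hx]
        refine ⟨hu1, hu2, fun ⟨h, a, b, c⟩ => hu3 ⟨h, a, hx.trans b, c⟩⟩
    · exact ⟨∅, fun h => absurd h hG⟩
  choose U hU using hroot
  set D : Finset (SimpleGraph V × V × (Fin L ↪ V)) := Finset.univ.filter fun x =>
    x.1 ∈ deficient V L s m ∧ x.2.1 ∈ U x.1 ∧ ∀ i, IsIsolated x.1 (x.2.2 i) with hD
  have hatt : ∀ x ∈ D, Attachable x.1 (consSeq x.2.1 x.2.2) L := by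
    rintro ⟨G, u, f⟩ hx
    simp only [hD, Finset.mem_filter, Finset.mem_univ, true_and] at hx
    obtain ⟨hG, hu, hf⟩ := hx
    obtain ⟨hu1, hu2, hu3⟩ := (hU G hG).2 u hu
    have hne : ∀ i, u ≠ f i := by
      rintro i rfl
      have hsub : reachSet G (f i) ⊆ {f i} := fun y hy => by
        refine mem_of_reachable (G := G) (S := {f i}) ?_ rfl hy
        rintro x rfl y hy
        exact absurd hy (hf i y)
      have := Set.ncard_le_ncard hsub
      rw [Set.ncard_singleton] at this
      omega
    have hidx : ∀ i, 0 < i → i ≤ L → ∃ j : Fin L, i = j + 1 := fun i hi hi' =>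
      ⟨⟨i - 1, by omega⟩, by simp; omega⟩
    refine ⟨hL, ?_, ?_, ?_, ?_, ?_⟩
    · intro i hi j hj hij
      have hi := Set.mem_Iic.1 hi
      have hj := Set.mem_Iic.1 hj
      rcases Nat.eq_zero_or_pos i with rfl | hi0 <;> rcases Nat.eq_zero_or_pos j with rfl | hj0
      · rfl
      · obtain ⟨j', rfl⟩ := hidx j hj0 hj
        rw [consSeq_zero, consSeq_succ] at hij
        exact absurd hij (hne j')
      · obtain ⟨i', rfl⟩ := hidx i hi0 hi
        rw [consSeq_zero, consSeq_succ] at hij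
        exact absurd hij.symm (hne i')
      · obtain ⟨j', rfl⟩ := hidx j hj0 hj
        obtain ⟨i', rfl⟩ := hidx i hi0 hi
        rw [consSeq_succ, consSeq_succ] at hij
        rw [f.injective hij]
    · intro i hi hi'
      obtain ⟨j, rfl⟩ := hidx i hi hi'
      rw [consSeq_succ]
      exact hf j
    · rw [consSeq_zero]
      exact hs.trans_le hu1
    · rw [consSeq_zero]
      exact hu2
    · rw [consSeq_zero]
      exact hu3
  have hinj : Set.InjOn (fun x : SimpleGraph V × V × (Fin L ↪ V) =>
      attachPath x.1 (consSeq x.2.1 x.2.2) L) (D : Set _) := by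
    intro x hx y hy hxy
    have S := hatt x (Finset.mem_coe.1 hx)
    have T := hatt y (Finset.mem_coe.1 hy)
    have hseq := fun i hi => S.path_eq T hxy (i := i) hi
    refine Prod.ext (S.graph_eq T hxy) (Prod.ext ?_ ?_)
    · simpa only [consSeq_zero] using hseq 0 (Nat.zero_le _)
    · ext i
      simpa only [consSeq_succ] using hseq (i + 1) i.2
  have hupper : ∑ x ∈ D, weight p x.1 * (p / (1 - p)) ^ L ≤ 1 := by
    rw [Finset.sum_congr rfl fun x hx => ((hatt x hx).weight_attach h1).symm]
    refine le_trans ?_ (sum_weight (V := V) p).le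
    rw [← Finset.sum_image (f := fun G => weight p G) hinj]
    exact Finset.sum_le_sum_of_subset_of_nonneg (Finset.subset_univ _)
      fun G _ _ => weight_nonneg h0.le h1.le G
  refine le_trans ?_ hupper
  rw [hD, Finset.sum_filter, Fintype.sum_prod_type, prob, Finset.sum_mul]
  refine Finset.sum_le_sum fun G _ => ?_
  have hw := weight_nonneg h0.le h1.le G
  by_cases hG : G ∈ deficient V L s m
  · simp only [hG, if_true, mul_one, true_and]
    rw [← Finset.sum_filter, Finset.sum_const, nsmul_eq_mul]
    have hcard : s * m.descFactorial L ≤ (Finset.univ.filter fun x : V × (Fin L ↪ V) =>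
        x.1 ∈ U G ∧ ∀ i, IsIsolated G (x.2 i)).card := by
      have h2 : Fintype.card (U G × (Fin L ↪ {v // IsIsolated G v})) ≤
          (Finset.univ.filter fun x : V × (Fin L ↪ V) =>
            x.1 ∈ U G ∧ ∀ i, IsIsolated G (x.2 i)).card := by
        rw [← Finset.card_univ]
        refine Finset.card_le_card_of_injOn
          (fun x => (x.1.1, x.2.trans (Function.Embedding.subtype _))) ?_ ?_
        · intro x _
          simpa using fun i => (x.2 i).2
        · intro x _ y _ hxy
          rw [Prod.mk.injEq] at hxy
          refine Prod.ext (Subtype.ext hxy.1) (Function.Embedding.ext fun i => Subtype.ext ?_)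
          exact congrArg (fun f : Fin L ↪ V => f i) hxy.2
      refine le_trans ?_ h2
      rw [Fintype.card_prod, Fintype.card_coe, Fintype.card_embedding_eq, Fintype.card_fin,
        Fintype.card_subtype]
      exact Nat.mul_le_mul (hU G hG).1 (Nat.descFactorial_le L hG.1)
    have hcard' : (s : ℝ) * (m.descFactorial L : ℕ) ≤ ((Finset.univ.filter
        fun x : V × (Fin L ↪ V) => x.1 ∈ U G ∧ ∀ i, IsIsolated G (x.2 i)).card : ℝ) := by
      exact_mod_cast hcard
    calc _ = (s : ℝ) * (m.descFactorial L : ℕ) * (weight p G * (p / (1 - p)) ^ L) := by ring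
      _ ≤ _ := mul_le_mul_of_nonneg_right hcard' (by positivity)
  · simp [hG]

end Switching

/-! ### From bare paths in the graph to degree-two paths in its components -/

section Bridge

theorem exists_walk_of_adj {W : Type*} {H : SimpleGraph W} (L : ℕ) (f : ℕ → W)
    (hadj : ∀ i < L, H.Adj (f i) (f (i + 1))) :
    ∃ w : H.Walk (f 0) (f L), w.length = L ∧ ∀ i ≤ L, w.getVert i = f i := by
  induction L generalizing f with
  | zero => exact ⟨SimpleGraph.Walk.nil, rfl, fun i hi => by simp [Nat.le_zero.1 hi]⟩
  | succ L ih =>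
    obtain ⟨w, hw, hw'⟩ := ih (fun i => f (i + 1)) fun i hi => hadj (i + 1) (by omega)
    refine ⟨SimpleGraph.Walk.cons (hadj 0 (by omega)) w, by simp [hw], fun i hi => ?_⟩
    cases i with
    | zero => simp
    | succ i =>
      rw [SimpleGraph.Walk.getVert_cons_succ]
      exact hw' i (by omega)

variable {V : Type*} [Fintype V] {G : SimpleGraph V}

omit [Fintype V] in
theorem supp_eq_reachSet {C : G.ConnectedComponent} {u : V} (hu : u ∈ C.supp) :
    C.supp = reachSet G u := by
  ext y
  rw [SimpleGraph.ConnectedComponent.mem_supp_iff] at hu ⊢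
  subst hu
  rw [SimpleGraph.ConnectedComponent.eq]
  exact ⟨fun h => h.symm, fun h => SimpleGraph.Reachable.symm h⟩

-- A bare interior vertex has just its two path neighbours, distinct by injectivity, hence degree
-- two inside the component as well.
omit [Fintype V] in
theorem bareFree_of_not_hasDegreeTwoPath {C : G.ConnectedComponent} [Fintype C] {u : V}
    (hu : u ∈ C.supp) {ℓ : ℝ} {L : ℕ} (hL : ℓ < L)
    (hC : ¬ HasDegreeTwoPath C.toSimpleGraph ℓ) : BareFree G u L := by
  classical
  rintro ⟨h, hinj, hreach, hadj, hbare⟩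
  have hmem : ∀ i ≤ L, h i ∈ C.supp := by
    intro i hi
    rw [supp_eq_reachSet hu]
    induction i with
    | zero => exact hreach
    | succ i ih =>
      exact SimpleGraph.Reachable.trans (ih (by omega)) (hadj i (by omega)).reachable
  set f : ℕ → C := fun i => if hi : i ≤ L then ⟨h i, hmem i hi⟩ else ⟨u, hu⟩ with hf
  have hfi : ∀ i, i ≤ L → (f i : V) = h i := fun i hi => by simp [hf, hi]
  have hfadj : ∀ i < L, C.toSimpleGraph.Adj (f i) (f (i + 1)) := by
    intro i hi
    have := hadj i hi
    rw [← hfi i hi.le, ← hfi (i + 1) hi] at this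
    exact this
  have hfinj : Set.InjOn f (Set.Iic L) := by
    intro i hi j hj hij
    have := congrArg Subtype.val hij
    rw [hfi i hi, hfi j hj] at this
    exact hinj hi hj this
  obtain ⟨w, hw, hw'⟩ := exists_walk_of_adj L f hfadj
  refine hC ⟨f 0, f L, w, ?_, by rwa [hw], fun i hi0 hi => ?_⟩
  · rw [← SimpleGraph.Walk.IsPath.getVert_injOn_iff]
    intro i hi j hj hij
    have hi : i ≤ L := hw ▸ hi
    have hj : j ≤ L := hw ▸ hj
    rw [hw' i hi, hw' j hj] at hij
    exact hfinj hi hj hij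
  · rw [hw] at hi
    rw [hw' i hi.le]
    obtain ⟨i, rfl⟩ : ∃ j, i = j + 1 := ⟨i - 1, by omega⟩
    have hN : C.toSimpleGraph.neighborFinset (f (i + 1)) = {f i, f (i + 2)} := by
      ext y
      rw [SimpleGraph.mem_neighborFinset, Finset.mem_insert, Finset.mem_singleton]
      constructor
      · intro hy
        have hy' : G.Adj (f (i + 1)) y := hy
        rw [hfi _ hi.le] at hy'
        rcases hbare (i + 1) hi0 hi y hy' with h1 | h1
        · left
          exact Subtype.ext (h1.trans (hfi i (by omega)).symm)
        · right
          exact Subtype.ext (h1.trans (hfi (i + 2) (by omega)).symm)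
      · rintro (rfl | rfl)
        · exact (hfadj i (by omega)).symm
        · exact hfadj (i + 1) (by omega)
    rw [← SimpleGraph.card_neighborFinset_eq_degree, hN, Finset.card_pair]
    intro h'
    have := hfinj (Set.mem_Iic.2 (by omega)) (Set.mem_Iic.2 (by omega)) h'
    omega

theorem le_ncard_of_path {k : ℕ} {Q : Fin (k + 1) → V} (hQ : Function.Injective Q)
    (hadj : ∀ i : Fin k, G.Adj (Q i.castSucc) (Q i.succ)) :
    k + 1 ≤ (reachSet G (Q 0)).ncard := by
  have hsub : Set.range Q ⊆ reachSet G (Q 0) := by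
    rintro _ ⟨i, rfl⟩
    induction i using Fin.induction with
    | zero => exact SimpleGraph.Reachable.refl _
    | succ i ih => exact SimpleGraph.Reachable.trans ih (hadj i).reachable
  have := Set.ncard_le_ncard hsub
  rwa [← Set.image_univ, hQ.injOn.ncard_image, Set.ncard_univ, Nat.card_fin] at this

open scoped Classical in
/-- All largest components have at least `s` vertices and a long path with interior degrees two. -/
def goodGiant (V : Type*) [Fintype V] (ℓ : ℝ) (s : ℕ) : Set (SimpleGraph V) :=
  {G | ∀ C : G.ConnectedComponent, IsLargest C →
    HasDegreeTwoPath C.toSimpleGraph ℓ ∧ s ≤ C.supp.ncard}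

/-- A path with k edges forces every largest component to have k + 1 vertices. If there are also
enough isolated vertices, the only remaining failure is deficiency. -/
theorem compl_goodGiant_subset {ℓ : ℝ} {L k m : ℕ} (hL : ℓ < L) :
    (goodGiant V ℓ (k + 1))ᶜ ⊆ {G : SimpleGraph V | ¬ ∃ Q : Fin (k + 1) → V,
        Function.Injective Q ∧ ∀ i : Fin k, G.Adj (Q i.castSucc) (Q i.succ)} ∪
      ({G | isolatedCount G < m} ∪ deficient V L (k + 1) m) := by
  classical
  intro G hG
  by_contra hcon
  simp only [Set.mem_union, Set.mem_ofPred_eq, not_or, not_not, not_lt] at hcon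
  obtain ⟨⟨Q, hQ, hadj⟩, hiso, hdef⟩ := hcon
  refine hG fun C hC => ?_
  have hlarge : ∀ x, (reachSet G x).ncard ≤ C.supp.ncard := by
    intro x
    have := hC (G.connectedComponentMk x)
    rwa [supp_eq_reachSet (C := G.connectedComponentMk x) (u := x) rfl] at this
  have hs : k + 1 ≤ C.supp.ncard := (le_ncard_of_path hQ hadj).trans (hlarge _)
  refine ⟨?_, hs⟩
  by_contra hpath
  obtain ⟨u, hu⟩ := C.nonempty_supp
  refine hdef ⟨hiso, u, ?_, ?_, bareFree_of_not_hasDegreeTwoPath hu hL ?_⟩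
  · rwa [← supp_eq_reachSet hu]
  · rwa [← supp_eq_reachSet hu]
  · convert hpath

end Bridge

/-! ### Numerical estimates -/

section Estimates

/-- With K²/n ≤ t, the power of 1 + KM/n is at most e^{tM}, while Bernoulli's inequality keeps the
falling factorial above n^K (1 - t). -/
theorem pow_mul_pow_le_descFactorial {n K : ℕ} {t M M₀ : ℝ} (hn : 0 < n) (ht : t < 1)
    (hKt : (K : ℝ) * K / n ≤ t) (hM : 0 ≤ M) (hM₀ : M ≤ M₀) :
    (n : ℝ) ^ K * (1 + K * M / n) ^ K ≤
      (1 + (Real.exp (t * M₀) / (1 - t) - 1)) * ((n.descFactorial K : ℕ) : ℝ) := by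
  have hn' : (0 : ℝ) < n := by exact_mod_cast hn
  have ht0 : 0 ≤ t := le_trans (by positivity) hKt
  have hKn : (K : ℝ) * K < n := by
    rw [div_le_iff₀ hn'] at hKt
    nlinarith
  have hKn' : K ≤ n := by
    have h1 : K * K < n := by exact_mod_cast hKn
    nlinarith
  have h1 : (1 + (K : ℝ) * M / n) ^ K ≤ Real.exp (t * M₀) := by
    have h2 : 1 + (K : ℝ) * M / n ≤ Real.exp (K * M / n) := by
      linarith [Real.add_one_le_exp ((K : ℝ) * M / n)]
    calc (1 + (K : ℝ) * M / n) ^ K ≤ Real.exp (K * M / n) ^ K := by gcongr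
      _ = Real.exp ((K : ℝ) * K / n * M) := by
        rw [← Real.exp_nat_mul]
        congr 1
        ring
      _ ≤ _ := by
        apply Real.exp_le_exp.2
        exact mul_le_mul hKt hM₀ hM ht0
  have h2 : (n : ℝ) ^ K * (1 - t) ≤ ((n.descFactorial K : ℕ) : ℝ) := by
    have h3 := one_add_mul_le_pow (a := -((K : ℝ) / n)) (by
      have : (K : ℝ) / n ≤ 1 := by
        rw [div_le_one hn']
        exact_mod_cast hKn'
      linarith) K
    have h4 : 1 - t ≤ (1 + -((K : ℝ) / n)) ^ K := by
      refine le_trans ?_ h3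
      have : (K : ℝ) * (K / n) = K * K / n := by ring
      linarith
    calc (n : ℝ) ^ K * (1 - t) ≤ (n : ℝ) ^ K * (1 + -((K : ℝ) / n)) ^ K := by gcongr
      _ = ((n - K : ℕ) : ℝ) ^ K := by
        rw [← mul_pow, Nat.cast_sub hKn']
        congr 1
        field_simp
        ring
      _ ≤ ((n + 1 - K : ℕ) : ℝ) ^ K := by
        gcongr
        omega
      _ ≤ _ := by exact_mod_cast Nat.pow_sub_le_descFactorial n K
  have h1t : 0 < 1 - t := by linarith
  calc (n : ℝ) ^ K * (1 + K * M / n) ^ K ≤ (n : ℝ) ^ K * Real.exp (t * M₀) := by gcongr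
    _ = Real.exp (t * M₀) / (1 - t) * ((n : ℝ) ^ K * (1 - t)) := by field_simp
    _ ≤ Real.exp (t * M₀) / (1 - t) * ((n.descFactorial K : ℕ) : ℝ) := by gcongr
    _ = _ := by ring

/-- A lower bound for the mean number of isolated vertices. -/
theorem mean_isolated_ge {n d : ℝ} {k : ℕ} (hk : (k : ℝ) ≤ n) (hn : 0 < n) (hd : 0 < d)
    (hdn : 2 * d ≤ n) (hdn2 : 20 * d ^ 2 ≤ n) :
    9 / 10 * (n * Real.exp (-d)) ≤ n * (1 - d / n) ^ k := by
  have hp : d / n ≤ 1 / 2 := by rw [div_le_iff₀ hn]; linarith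
  have hp0 : 0 < d / n := by positivity
  have hq : 0 < 1 - d / n := by linarith
  have hlog : -(d / n) - 2 * (d / n) ^ 2 ≤ Real.log (1 - d / n) := by
    have h1 := Real.one_sub_inv_le_log_of_pos hq
    refine le_trans ?_ h1
    rw [inv_eq_one_div, le_sub_iff_add_le, ← le_sub_iff_add_le', div_le_iff₀ hq]
    nlinarith
  have h2 : -d - 1 / 10 ≤ k * Real.log (1 - d / n) := by
    have hneg : Real.log (1 - d / n) ≤ 0 := Real.log_nonpos hq.le (by linarith)
    have h3 : n * Real.log (1 - d / n) ≤ k * Real.log (1 - d / n) :=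
      mul_le_mul_of_nonpos_right hk hneg
    have h4 := mul_le_mul_of_nonneg_left hlog hn.le
    have h5 : n * (-(d / n) - 2 * (d / n) ^ 2) = -d - 2 * d ^ 2 / n := by field_simp
    have h6 : 2 * d ^ 2 / n ≤ 1 / 10 := by rw [div_le_iff₀ hn]; linarith
    linarith
  have h3 : (1 - d / n) ^ k = Real.exp (k * Real.log (1 - d / n)) := by
    rw [Real.exp_nat_mul, Real.exp_log hq]
  have h4 : 9 / 10 * Real.exp (-d) ≤ (1 - d / n) ^ k := by
    rw [h3]
    refine le_trans ?_ (Real.exp_le_exp.2 h2)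
    rw [sub_eq_add_neg, Real.exp_add, mul_comm]
    have := Real.add_one_le_exp (-(1 / 10 : ℝ))
    have h0 := Real.exp_pos (-d)
    nlinarith
  nlinarith

/-- A lower bound for the expected number of bare paths per attachment site. -/
theorem exp_le_pow {x d : ℝ} {L : ℕ} (hd : 1 < d) (hdx : 5 * d < x)
    (hL : (L : ℝ) ≤ x / (4 * d) + 1) :
    Real.exp (-(9 / 20) * x - 3) ≤ (d * Real.exp (-d) / 2) ^ L := by
  have hd0 : 0 < d := by linarith
  have hpos : 0 < d * Real.exp (-d) / 2 := by positivity
  have h3 : (d * Real.exp (-d) / 2) ^ L = Real.exp (L * (Real.log (d / 2) - d)) := by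
    rw [Real.exp_nat_mul, sub_eq_add_neg, Real.exp_add, Real.exp_log (by positivity)]
    congr 1
    ring
  rw [h3]
  apply Real.exp_le_exp.2
  have hL0 : (0 : ℝ) ≤ L := Nat.cast_nonneg L
  have hLd : (L : ℝ) * d ≤ x / 4 + d := by
    have := mul_le_mul_of_nonneg_right hL hd0.le
    have h4 : (x / (4 * d) + 1) * d = x / 4 + d := by field_simp
    linarith
  -- For d ≥ 2 the logarithm is nonnegative and Ld ≤ x/4 + d < (1/4 + 1/5)x gives 9/20. For d ≤ 2
  -- the logarithm costs up to 7/10 per factor, but d is bounded: the total is at most (17/40)x +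
  -- 2.7.
  rcases le_total 2 d with h2 | h2
  · have : 0 ≤ Real.log (d / 2) := Real.log_nonneg (by linarith)
    nlinarith
  · have hlog : -(7 / 10) ≤ Real.log (d / 2) := by
      have h5 : Real.log (1 / 2) ≤ Real.log (d / 2) :=
        Real.log_le_log (by norm_num) (by linarith)
      rw [one_div, Real.log_inv] at h5
      linarith [Real.log_two_lt_d9]
    have hL2 : (L : ℝ) ≤ x / 4 + 1 := by
      refine hL.trans ?_
      have : x / (4 * d) ≤ x / 4 := div_le_div_of_nonneg_left (by linarith) (by norm_num)
        (by linarith)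
      linarith
    nlinarith

end Estimates

/-! ### Failure probabilities and the limit, with x = ln n -/

section Asymptotics

/-- The bound for the probability that a largest component fails to be good. -/
noncomputable def failureBound (ε x : ℝ) : ℝ :=
  (Real.exp (4 * Real.exp (-(1 / 25) * x) * (1 + 2 / ε)) / (1 - 4 * Real.exp (-(1 / 25) * x)) - 1) +
    ((10 / 9 * Real.exp (-(4 / 5) * x) + 2 * (x * Real.exp (-x))) / (1 / 4) ^ 2 +
      Real.exp (3 - 3 / 100 * x))

/-- From d < x/5 the mean is at least (9/10) n^{4/5}, and p/(1-p) ≤ 2p ≤ 2x/n. -/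
theorem prob_isolated_lt {n : ℕ} {p d x : ℝ} (hn : Real.exp x = n) (hd : d = p * n)
    (hd1 : 1 < d) (hdx : 5 * d < x) (hx : 20 * x ^ 2 ≤ Real.exp x) :
    prob p {G : SimpleGraph (Fin n) |
      (isolatedCount G : ℝ) ≤ (1 - 1 / 4) * (n * (1 - p) ^ (n - 1))} ≤
      (10 / 9 * Real.exp (-(4 / 5) * x) + 2 * (x * Real.exp (-x))) / (1 / 4) ^ 2 := by
  have hnpos : (0 : ℝ) < n := hn ▸ Real.exp_pos x
  have hn0 : 0 < n := by exact_mod_cast hnpos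
  have : Nonempty (Fin n) := ⟨⟨0, hn0⟩⟩
  have hp : p = d / n := by rw [hd]; field_simp
  have hp0 : 0 < p := by rw [hp]; exact div_pos (by linarith) hnpos
  have hpx : p ≤ x * Real.exp (-x) := by
    rw [hp, div_le_iff₀ hnpos, ← hn, mul_assoc, ← Real.exp_add, neg_add_cancel, Real.exp_zero]
    linarith
  have hp2 : p ≤ 1 / 2 := by
    rw [hp, div_le_iff₀ hnpos, ← hn]
    nlinarith
  have hmean := mean_isolated_ge (n := n) (d := d) (k := n - 1)
    (by exact_mod_cast Nat.sub_le n 1) hnpos (by linarith) (by rw [← hn]; nlinarith)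
    (by rw [← hn]; nlinarith)
  rw [← hp] at hmean
  have hcheb := prob_isolatedCount (V := Fin n) hp0.le (by linarith) (δ := 1 / 4)
    (m := n * (1 - p) ^ (n - 1)) (by rw [Fintype.card_fin]) (by norm_num)
  refine hcheb.trans ?_
  gcongr
  · have h1 : 9 / 10 * Real.exp (4 / 5 * x) ≤ n * (1 - p) ^ (n - 1) := by
      refine le_trans ?_ hmean
      rw [← hn, ← Real.exp_add]
      gcongr
      linarith
    calc 1 / (n * (1 - p) ^ (n - 1)) ≤ 1 / (9 / 10 * Real.exp (4 / 5 * x)) :=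
          one_div_le_one_div_of_le (by positivity) h1
      _ = _ := by
          rw [show -(4 / 5) * x = -(4 / 5 * x) by ring, Real.exp_neg]
          field_simp
  · rw [div_le_iff₀ (by linarith)]
    nlinarith

theorem prob_deficient_le {n : ℕ} {p d x : ℝ} {L s : ℕ} (hn : Real.exp x = n) (hd : d = p * n)
    (hd1 : 1 < d) (hdx : 5 * d < x) (hx : 20 * x ^ 2 ≤ Real.exp x)
    (hx2 : x / 4 + 1 ≤ 1 / 10 * Real.exp (4 / 5 * x))
    (hx3 : x / 4 + 1 < Real.exp (12 / 25 * x)) (hL0 : 0 < L) (hL : (L : ℝ) ≤ x / (4 * d) + 1)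
    (hs : Real.exp (12 / 25 * x) ≤ s) :
    prob p (deficient (Fin n) L s ⌈(1 - 1 / 4 : ℝ) * (n * (1 - p) ^ (n - 1))⌉₊) ≤
      Real.exp (3 - 3 / 100 * x) := by
  have hnpos : (0 : ℝ) < n := hn ▸ Real.exp_pos x
  have hp : p = d / n := by rw [hd]; field_simp
  have hp0 : 0 < p := by rw [hp]; exact div_pos (by linarith) hnpos
  have hp2 : p ≤ 1 / 2 := by
    rw [hp, div_le_iff₀ hnpos, ← hn]
    nlinarith
  have hmean := mean_isolated_ge (n := n) (d := d) (k := n - 1)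
    (by exact_mod_cast Nat.sub_le n 1) hnpos (by linarith) (by rw [← hn]; nlinarith)
    (by rw [← hn]; nlinarith)
  rw [← hp] at hmean
  set m := ⌈(1 - 1 / 4 : ℝ) * (n * (1 - p) ^ (n - 1))⌉₊ with hm
  have hL2 : (L : ℝ) ≤ x / 4 + 1 := by
    have : x / (4 * d) ≤ x / 4 := div_le_div_of_nonneg_left (by linarith) (by norm_num)
      (by linarith)
    linarith
  have hLs : L < s := by
    have : (L : ℝ) < s := by linarith
    exact_mod_cast this
  have hbig : Real.exp (4 / 5 * x) ≤ n * Real.exp (-d) := by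
    rw [← hn, ← Real.exp_add]
    gcongr
    linarith
  -- The factors 3/4 and 9/10 leave 0.675 of n e^{-d}, and L takes at most another tenth.
  have hmL : n * Real.exp (-d) / 2 ≤ ((m + 1 - L : ℕ) : ℝ) := by
    have h1 : (1 - 1 / 4 : ℝ) * (n * (1 - p) ^ (n - 1)) ≤ m := Nat.le_ceil _
    have h2 : (m : ℝ) + 1 ≤ ((m + 1 - L : ℕ) : ℝ) + L := by
      have : m + 1 ≤ (m + 1 - L) + L := by omega
      exact_mod_cast this
    linarith
  have hdesc : (n * Real.exp (-d) / 2) ^ L ≤ ((m.descFactorial L : ℕ) : ℝ) := by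
    calc (n * Real.exp (-d) / 2) ^ L ≤ ((m + 1 - L : ℕ) : ℝ) ^ L := by gcongr
      _ ≤ _ := by exact_mod_cast Nat.pow_sub_le_descFactorial m L
  have hr : p ^ L ≤ (p / (1 - p)) ^ L := by
    gcongr
    rw [le_div_iff₀ (by linarith)]
    nlinarith
  -- The gain n^{12/25} from the attachment points beats the loss n^{-9/20}: 12/25 - 9/20 = 3/100.
  have hZ : Real.exp (3 / 100 * x - 3) ≤
      s * ((m.descFactorial L : ℕ) : ℝ) * (p / (1 - p)) ^ L := by
    calc Real.exp (3 / 100 * x - 3)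
        = Real.exp (12 / 25 * x) * Real.exp (-(9 / 20) * x - 3) := by
          rw [← Real.exp_add]
          congr 1
          ring
      _ ≤ Real.exp (12 / 25 * x) * (d * Real.exp (-d) / 2) ^ L := by
          gcongr
          exact exp_le_pow hd1 hdx hL
      _ = Real.exp (12 / 25 * x) * (n * Real.exp (-d) / 2) ^ L * p ^ L := by
          rw [mul_assoc, ← mul_pow, hd]
          congr 2
          ring
      _ ≤ _ := by gcongr
  have h := prob_deficient (V := Fin n) hp0 (by linarith) (m := m) hL0 hLs
  have h0 := prob_nonneg hp0.le (by linarith) (deficient (Fin n) L s m)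
  have h1 := (mul_le_mul_of_nonneg_left hZ h0).trans h
  rw [show 3 - 3 / 100 * x = -(3 / 100 * x - 3) by ring, Real.exp_neg, ← one_div,
    le_div_iff₀ (Real.exp_pos _)]
  exact h1

/-- For k = ⌊n^{12/25}⌋ one has (k+1)²/n ≤ 4 n^{-1/25}. With ρ = 1/d the constant M is 1 + 2/(d-1),
bounded by 1 + 2/ε uniformly in n. -/
theorem prob_no_long_path {n : ℕ} {p d x ε : ℝ} (hε : 0 < ε) (hn : Real.exp x = n)
    (hd : d = p * n) (hd1 : 1 + ε < d) (hx0 : 0 ≤ x) (hp1 : p ≤ 1)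
    (ht : 4 * Real.exp (-(1 / 25) * x) < 1) :
    prob p {G : SimpleGraph (Fin n) | ¬ ∃ Q : Fin (⌊Real.exp (12 / 25 * x)⌋₊ + 1) → Fin n,
      Function.Injective Q ∧ ∀ i : Fin ⌊Real.exp (12 / 25 * x)⌋₊,
        G.Adj (Q i.castSucc) (Q i.succ)} ≤
      Real.exp (4 * Real.exp (-(1 / 25) * x) * (1 + 2 / ε)) /
        (1 - 4 * Real.exp (-(1 / 25) * x)) - 1 := by
  have hnpos : (0 : ℝ) < n := hn ▸ Real.exp_pos x
  have hn0 : 0 < n := by exact_mod_cast hnpos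
  have hp : p = d / n := by rw [hd]; field_simp
  have hp0 : 0 < p := by rw [hp]; exact div_pos (by linarith) hnpos
  set k := ⌊Real.exp (12 / 25 * x)⌋₊ with hk
  set t := 4 * Real.exp (-(1 / 25) * x) with htdef
  have hkle : ((k + 1 : ℕ) : ℝ) ≤ 2 * Real.exp (12 / 25 * x) := by
    have h1 := Nat.floor_le (Real.exp_pos (12 / 25 * x)).le
    have h2 : 1 ≤ Real.exp (12 / 25 * x) := Real.one_le_exp (by linarith)
    push_cast
    linarith
  have hKt : ((k + 1 : ℕ) : ℝ) * (k + 1 : ℕ) / n ≤ t := by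
    rw [div_le_iff₀ hnpos, ← hn, htdef, mul_assoc, ← Real.exp_add]
    calc ((k + 1 : ℕ) : ℝ) * (k + 1 : ℕ) ≤
          2 * Real.exp (12 / 25 * x) * (2 * Real.exp (12 / 25 * x)) := by gcongr
      _ = 4 * (Real.exp (12 / 25 * x) * Real.exp (12 / 25 * x)) := by ring
      _ = _ := by
        rw [← Real.exp_add]
        congr 2
        ring
  have hkn : k + 1 ≤ n := by
    rw [div_le_iff₀ hnpos] at hKt
    have h1 : ((k + 1 : ℕ) : ℝ) * (k + 1 : ℕ) < n := by nlinarith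
    have h2 : (k + 1) * (k + 1) < n := by exact_mod_cast h1
    nlinarith
  have hd0 : 0 < d := by linarith
  have hM : 1 + 2 * (1 / d / (1 - 1 / d)) ≤ 1 + 2 / ε := by
    have h1 : 1 / d / (1 - 1 / d) = 1 / (d - 1) := by
      have : d - 1 ≠ 0 := by linarith
      have : 1 - 1 / d ≠ 0 := by
        rw [one_sub_div hd0.ne']
        positivity
      field_simp
    rw [h1]
    have h2 : 1 / (d - 1) ≤ 1 / ε := one_div_le_one_div_of_le hε (by linarith)
    have h3 : 2 / ε = 2 * (1 / ε) := by ring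
    linarith
  have hρ1 : 1 / d < 1 := by
    rw [div_lt_one hd0]
    linarith
  have hM0 : 0 ≤ 1 + 2 * (1 / d / (1 - 1 / d)) := by
    have : 0 < 1 - 1 / d := by linarith
    positivity
  have hbound := pow_mul_pow_le_descFactorial hn0 ht hKt hM0 hM
  refine prob_no_path (V := Fin n) (k := k) (n := n) hp0 hp1 (by rw [Fintype.card_fin])
    (by rwa [Fintype.card_fin]) (ρ := 1 / d) (by rw [hd]; field_simp) hρ1 rfl rfl ?_
  rw [Fintype.card_fin]
  push_cast at hbound ⊢
  exact hbound

/-- Largest components are good outside an event of small probability. -/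
theorem prob_compl_goodGiant_le {n : ℕ} {p d x ε : ℝ} (hε : 0 < ε) (hn : Real.exp x = n)
    (hd : d = p * n) (hd1 : 1 + ε < d) (hdx : 5 * d < x) (hx : 20 * x ^ 2 ≤ Real.exp x)
    (hx2 : x / 4 + 1 ≤ 1 / 10 * Real.exp (4 / 5 * x))
    (hx3 : x / 4 + 1 < Real.exp (12 / 25 * x)) (ht : 4 * Real.exp (-(1 / 25) * x) < 1) :
    prob p (goodGiant (Fin n) (x / (4 * d)) (⌊Real.exp (12 / 25 * x)⌋₊ + 1))ᶜ ≤
      failureBound ε x := by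
  have hnpos : (0 : ℝ) < n := hn ▸ Real.exp_pos x
  have hp : p = d / n := by rw [hd]; field_simp
  have hp0 : 0 < p := by rw [hp]; exact div_pos (by linarith) hnpos
  have hp2 : p ≤ 1 := by
    rw [hp, div_le_iff₀ hnpos, ← hn]
    nlinarith
  have hd0 : 0 < d := by linarith
  have hxd : 0 ≤ x / (4 * d) := div_nonneg (by linarith) (by linarith)
  refine (prob_mono hp0.le hp2 (compl_goodGiant_subset (L := ⌊x / (4 * d)⌋₊ + 1)
    (m := ⌈(1 - 1 / 4 : ℝ) * (n * (1 - p) ^ (n - 1))⌉₊) ?_)).trans ?_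
  · push_cast
    exact Nat.lt_floor_add_one _
  refine (prob_union_le hp0.le hp2 _ _).trans (add_le_add ?_ ?_)
  · exact prob_no_long_path hε hn hd hd1 (by linarith) hp2 ht
  refine (prob_union_le hp0.le hp2 _ _).trans (add_le_add ?_ ?_)
  · refine (prob_mono hp0.le hp2 ?_).trans
      (prob_isolated_lt hn hd (by linarith) hdx hx)
    exact fun G hG => (Nat.lt_ceil.1 hG).le
  · refine prob_deficient_le hn hd (by linarith) hdx hx hx2 hx3 (Nat.succ_pos _) ?_ ?_
    · push_cast
      linarith [Nat.floor_le hxd]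
    · push_cast
      exact (Nat.lt_floor_add_one _).le

theorem tendsto_exp_neg_mul {a : ℝ} (ha : 0 < a) :
    Tendsto (fun x : ℝ => Real.exp (-a * x)) atTop (𝓝 0) := by
  refine Real.tendsto_exp_atBot.comp ?_
  exact (tendsto_id.const_mul_atTop_of_neg (by linarith : -a < 0))

theorem tendsto_failureBound (ε : ℝ) : Tendsto (failureBound ε) atTop (𝓝 0) := by
  have h1 := (tendsto_exp_neg_mul (a := 1 / 25) (by norm_num)).const_mul 4
  have h2 := tendsto_exp_neg_mul (a := 4 / 5) (by norm_num)
  have h3 : Tendsto (fun x : ℝ => x * Real.exp (-x)) atTop (𝓝 0) := by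
    simpa using Real.tendsto_pow_mul_exp_neg_atTop_nhds_zero 1
  have h4 : Tendsto (fun x : ℝ => Real.exp (3 - 3 / 100 * x)) atTop (𝓝 0) := by
    have := (tendsto_exp_neg_mul (a := 3 / 100) (by norm_num)).const_mul (Real.exp 3)
    rw [mul_zero] at this
    refine this.congr fun x => ?_
    rw [← Real.exp_add]
    congr 1
    ring
  rw [mul_zero] at h1
  have h5 := ((((Real.continuous_exp.tendsto _).comp (h1.mul_const (1 + 2 / ε))).div
    (h1.const_sub 1) (by norm_num)).sub_const 1).add
      ((((h2.const_mul (10 / 9)).add (h3.const_mul 2)).div_const ((1 / 4) ^ 2)).add h4)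
  have h6 : (Real.exp (0 * (1 + 2 / ε)) / (1 - 0) - 1) +
      ((10 / 9 * 0 + 2 * 0) / (1 / 4) ^ 2 + 0) = (0 : ℝ) := by norm_num
  rw [← h6]
  exact h5

theorem eventually_mul_add_le_exp {a : ℝ} (ha : 0 < a) (b c : ℝ) :
    ∀ᶠ x : ℝ in atTop, b * x + c < Real.exp (a * x) := by
  have h1 : Tendsto (fun x : ℝ => x * Real.exp (-a * x)) atTop (𝓝 0) := by
    have h := (Real.tendsto_pow_mul_exp_neg_atTop_nhds_zero 1).comp
      (tendsto_id.const_mul_atTop ha)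
    have h' := h.const_mul (1 / a)
    rw [mul_zero] at h'
    refine h'.congr fun x => ?_
    simp only [Function.comp_apply, id, pow_one]
    rw [neg_mul]
    field_simp
  have h2 := (h1.const_mul b).add ((tendsto_exp_neg_mul ha).const_mul c)
  rw [mul_zero, mul_zero, add_zero] at h2
  filter_upwards [h2.eventually (gt_mem_nhds one_pos)] with x hx
  have h3 : (b * x + c) * Real.exp (-a * x) < 1 := by linarith
  rw [neg_mul, Real.exp_neg, ← div_eq_mul_inv, div_lt_one (Real.exp_pos _)] at h3
  exact h3

theorem eventually_sq_le_exp : ∀ᶠ x : ℝ in atTop, 20 * x ^ 2 ≤ Real.exp x := by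
  have h := (Real.tendsto_pow_mul_exp_neg_atTop_nhds_zero 2).const_mul 20
  rw [mul_zero] at h
  filter_upwards [h.eventually (gt_mem_nhds one_pos)] with x hx
  rw [← mul_assoc, Real.exp_neg, ← div_eq_mul_inv, div_lt_one (Real.exp_pos _)] at hx
  exact hx.le

theorem tendsto_log_natCast : Tendsto (fun n : ℕ => Real.log n) atTop atTop :=
  Real.tendsto_log_atTop.comp tendsto_natCast_atTop_atTop

/-- A property implied by goodness holds asymptotically almost surely. -/
theorem aasGiant_of_good {ε : ℝ} {p : ℕ → I} {d : ℕ → ℝ} (hε : 0 < ε)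
    (hd : ∀ n : ℕ, d n = (p n : ℝ) * n)
    (hp : ∀ᶠ n : ℕ in atTop,
      (1 + ε) / (n : ℝ) < (p n : ℝ) ∧ (p n : ℝ) < Real.log n / (5 * (n : ℝ)))
    (Q : ℕ → ∀ {W : Type} [Fintype W], SimpleGraph W → Prop)
    (hQ : ∀ᶠ n : ℕ in atTop, 1 < d n → 5 * d n < Real.log n →
      ∀ {W : Type} [Fintype W] (H : SimpleGraph W), H.Connected →
        HasDegreeTwoPath H (Real.log n / (4 * d n)) →
        ⌊Real.exp (12 / 25 * Real.log n)⌋₊ + 1 ≤ Fintype.card W → Q n H) :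
    AASGiant p Q := by
  have hlog := tendsto_log_natCast
  have hlim : Tendsto (fun n : ℕ => ENNReal.ofReal (1 - failureBound ε (Real.log n))) atTop
      (𝓝 1) := by
    have := ENNReal.tendsto_ofReal (((tendsto_failureBound ε).comp hlog).const_sub 1)
    simpa using this
  refine tendsto_of_tendsto_of_tendsto_of_le_of_le' hlim tendsto_const_nhds ?_
    (Eventually.of_forall fun n => MeasureTheory.prob_le_one)
  filter_upwards [hp, hQ, eventually_gt_atTop 0, hlog.eventually eventually_sq_le_exp,
    hlog.eventually (eventually_mul_add_le_exp (a := 4 / 5) (by norm_num) (10 / 4) 10),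
    hlog.eventually (eventually_mul_add_le_exp (a := 12 / 25) (by norm_num) (1 / 4) 1),
    hlog.eventually (eventually_mul_add_le_exp (a := 1 / 25) (by norm_num) 0 4)]
    with n hpn hQn hn0 hx hx2 hx3 hx4
  have hn : (0 : ℝ) < n := by exact_mod_cast hn0
  have hd1 : 1 + ε < d n := by
    rw [hd]
    exact (div_lt_iff₀ hn).1 hpn.1
  have hdx : 5 * d n < Real.log n := by
    rw [hd]
    have := (lt_div_iff₀ (by positivity)).1 hpn.2
    linarith
  have ht : 4 * Real.exp (-(1 / 25) * Real.log n) < 1 := by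
    rw [neg_mul, Real.exp_neg, ← div_eq_mul_inv, div_lt_one (Real.exp_pos _)]
    linarith
  have hbound := prob_compl_goodGiant_le (n := n) (p := p n) (d := d n) (x := Real.log n) hε
    (Real.exp_log hn) (hd n) hd1 hdx hx (by linarith) (by linarith) ht
  rw [prob_compl] at hbound
  rw [binomialRandom_eq_prob]
  refine ENNReal.ofReal_le_ofReal ?_
  refine le_trans (by linarith) (prob_mono (p n).2.1 (p n).2.2 ?_)
  intro G hG C hC
  obtain ⟨h1, h2⟩ := hG C hC
  classical
  refine hQn (by linarith) hdx _ C.connected_toSimpleGraph h1 ?_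
  rw [← Nat.card_coe_set_eq] at h2
  rw [← Nat.card_eq_fintype_card]
  exact h2

theorem mixing_eventually {d : ℕ → ℝ} : ∀ᶠ n : ℕ in atTop, 1 < d n → 5 * d n < Real.log n →
    ∀ {W : Type} [Fintype W] (H : SimpleGraph W), H.Connected →
      HasDegreeTwoPath H (Real.log n / (4 * d n)) →
      ⌊Real.exp (12 / 25 * Real.log n)⌋₊ + 1 ≤ Fintype.card W →
      ENNReal.ofReal (1 / 10 * (Real.log n / (8 * d n)) ^ 2) < ((mixingTime H : ℕ∞) : ℝ≥0∞) ∧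
      ENNReal.ofReal (1 / 10 * (Real.log n / (8 * d n)) ^ 2) <
        ((averagedMixingTime H : ℕ∞) : ℝ≥0∞) := by
  -- A connected graph has at least |V| - 1 edges. With μ ≤ x/8 the requirement 20 μ + 10 becomes
  -- (20/8)x + 10, and the floor costs one more.
  filter_upwards [tendsto_log_natCast.eventually
    (eventually_mul_add_le_exp (a := 12 / 25) (by norm_num) (20 / 8) 11)]
    with n hx hd1 hdx W _ H hconn hpath hcard
  classical
  have hd0 : 0 < d n := by linarith
  refine mixing_of_hasDegreeTwoPath H ?_ ?_ ?_
  · rw [le_div_iff₀ (by positivity)]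
    linarith
  · convert hpath using 1
    field_simp
    ring
  · have h1 := hconn.card_vert_le_card_edgeSet_add_one
    rw [Nat.card_eq_fintype_card, Nat.card_eq_fintype_card] at h1
    have h2 : ⌊Real.exp (12 / 25 * Real.log n)⌋₊ ≤ H.edgeFinset.card := by
      rw [SimpleGraph.edgeFinset_card]
      omega
    have h3 : ((⌊Real.exp (12 / 25 * Real.log n)⌋₊ : ℕ) : ℝ) ≤ H.edgeFinset.card := by
      exact_mod_cast h2
    have h4 := Nat.lt_floor_add_one (Real.exp (12 / 25 * Real.log n))
    have h5 : Real.log n / (8 * d n) ≤ Real.log n / 8 :=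
      div_le_div_of_nonneg_left (by linarith) (by norm_num) (by linarith)
    linarith

end Asymptotics

end GiantWalk

theorem mainTheorem6 :
    ∃ c : ℝ, 0 < c ∧
      ∀ (ε : ℝ) (p : ℕ → unitInterval) (d : ℕ → ℝ), 0 < ε →
        (∀ n : ℕ, d n = (p n : ℝ) * n) →
        (∀ᶠ n : ℕ in atTop,
          (1 + ε) / (n : ℝ) < (p n : ℝ) ∧ (p n : ℝ) < Real.log n / (5 * (n : ℝ))) →
        GiantWalk.AASGiant p (fun n _ _ H =>
          GiantWalk.HasDegreeTwoPath H (Real.log n / (4 * d n))) ∧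
        GiantWalk.AASGiant p (fun n _ _ H =>
          ENNReal.ofReal (1 / 10 * (Real.log n / (8 * d n)) ^ 2) <
            ((GiantWalk.mixingTime H : ℕ∞) : ℝ≥0∞)) ∧
        GiantWalk.AASGiant p (fun n _ _ H =>
          ENNReal.ofReal (c * (Real.log n / d n) ^ 2) <
            ((GiantWalk.averagedMixingTime H : ℕ∞) : ℝ≥0∞)) := by
  -- 1/640 = (1/10)(1/8)², so the averaged bound is the same quantity as the unaveraged one.
  refine ⟨1 / 640, by norm_num, fun ε p d hε hd hp => ⟨?_, ?_, ?_⟩⟩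
  · exact GiantWalk.aasGiant_of_good hε hd hp _
      (Eventually.of_forall fun n _ _ W _ H _ h _ => h)
  · refine GiantWalk.aasGiant_of_good hε hd hp _ ?_
    filter_upwards [GiantWalk.mixing_eventually (d := d)] with n h h1 h2 W _ H h3 h4 h5
    exact (h h1 h2 H h3 h4 h5).1
  · refine GiantWalk.aasGiant_of_good hε hd hp _ ?_
    filter_upwards [GiantWalk.mixing_eventually (d := d)] with n h h1 h2 W _ H h3 h4 h5
    have h6 := (h h1 h2 H h3 h4 h5).2
    have h7 : 1 / 640 * (Real.log n / d n) ^ 2 = 1 / 10 * (Real.log n / (8 * d n)) ^ 2 := by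
      have : d n ≠ 0 := by linarith
      field_simp
      ring
    rwa [h7]
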